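/- Let $D$ be a positive squarefree integer with $D\equiv 1 \pmod 8$. For integers $A,B$ let $S^{(D;A,B)}\subset\mathbb P^4$ be the surface given by $$t_0t_1=t_2^2-Dt_3^2,\qquad (t_0+At_1)(t_0+Bt_1)=t_2^2-Dt_4^2,$$ and let $R_D^{\mathrm{loc}}(N)$ be the number of pairs of integers $(A,B)$ with $|A|,|B|\le N$ such that $S^{(D;A,B)}(\mathbb R)\neq\emptyset$ and $S^{(D;A,B)}(\mathbb Q_p)\ne\emptyset$ for all primes $p$. Put $G(A,B)=A^2-2AB+B^2-2A-2B+1$. For a prime $p\mid D$ and $l\ge 1$ let $\mathcal R_l(p)$ be the set of pairs $(A,B)$ of residue classes modulo $p^{8l+1}$ such that $p^{l+1}$ divides none of $A$, $B$, $A-B$, $G(A,B)$ and such that the two equations above, read as congruences modulo $p^{8l+1}$, have a solution $(t_0,\dots,t_4)$ whose components are not all divisible by $p$; put $\mathcal R_0(p)=\emptyset$. Let $\mathcal R_l^*(p)$ be the set of those elements of $\mathcal R_l(p)$ whose reduction modulo $p^{8(l-1)+1}$ does not lie in $\mathcal R_{l-1}(p)$. Set $$\sigma_p=\sum_{l=1}^{\infty}\frac{|\mathcal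 R_l^*(p)|}{p^{2(8l+1)}},\qquad c_{\mathrm{loc}}=4\prod_{p\mid D}\sigma_p .$$ Then the series $\sigma_p$ converge, there is some $\theta(D)>0$ such that for all real $N\ge 1$ $$R_D^{\mathrm{loc}}(N)=c_{\mathrm{loc}}N^2+O_D\bigl(N^{2-\theta(D)}\bigr),$$ and $c_{\mathrm{loc}}\ge 4/D^2>0$. Moreover $c_{\mathrm{loc}}/4$ is a product of local densities: for every prime $p\mid D$, $\sigma_p$ is the measure of the set of all $(A,B)\in\mathbb Z_p^2$ with $S^{(D;A,B)}(\mathbb Q_p)\neq\emptyset$, for the Haar measure on $\mathbb Z_p^2$ of total mass $1$. -/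

import Mathlib

open scoped LinearAlgebra.Projectivization

namespace BSDSurface

/-- The first quadratic form `t₂² - D t₃² - t₀ t₁`. -/
def Q1 {R : Type*} [CommRing R] (D : R) (t : Fin 5 → R) : R :=
  t 2 ^ 2 - D * t 3 ^ 2 - t 0 * t 1

/-- The second quadratic form `t₂² - D t₄² - (t₀ + A t₁) (t₀ + B t₁)`. -/
def Q2 {R : Type*} [CommRing R] (D A B : R) (t : Fin 5 → R) : R :=
  t 2 ^ 2 - D * t 4 ^ 2 - (t 0 + A * t 1) * (t 0 + B * t 1)

/-- The polynomial `G(A,B) = A² - 2AB + B² - 2A - 2B + 1`. -/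
def G {R : Type*} [CommRing R] (A B : R) : R :=
  A ^ 2 - 2 * A * B + B ^ 2 - 2 * A - 2 * B + 1

/-- The set `S^{(D;A,B)}(K)` of `K`-rational points, inside projective four-space over `K`.
As `Q1` and `Q2` are homogeneous, the choice of the representative is immaterial. -/
def points {K : Type*} [Field K] (D A B : K) : Set (ℙ K (Fin 5 → K)) :=
  {P | Q1 D P.rep = 0 ∧ Q2 D A B P.rep = 0}

/-- `S^{(D;A,B)}` has points over `ℝ` and over `ℚ_p` for all primes `p`. -/
def EverywhereLocallySoluble (D A B : ℤ) : Prop :=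
  (points (D : ℝ) (A : ℝ) (B : ℝ)).Nonempty ∧
    ∀ (p : ℕ) [Fact p.Prime], (points (D : ℚ_[p]) (A : ℚ_[p]) (B : ℚ_[p])).Nonempty

/-- `R_D^loc(N)`: the number of integer pairs `(A, B)` with `|A|, |B| ≤ N` such that
`S^{(D;A,B)}` is everywhere locally soluble. -/
noncomputable def Rloc (D : ℤ) (N : ℝ) : ℕ :=
  Set.ncard {x : ℤ × ℤ | |(x.1 : ℝ)| ≤ N ∧ |(x.2 : ℝ)| ≤ N ∧
    EverywhereLocallySoluble D x.1 x.2}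

/-- The set `𝓡_l(p)` of pairs of residue classes `(A, B)` modulo `p^(8l+1)` such that `p^(l+1)`
divides none of `A`, `B`, `A - B`, `G(A,B)`, and such that the system `Q1 = Q2 = 0` has a
primitive solution modulo `p^(8l+1)`; it is empty for `l = 0`. -/
def calR (D : ℤ) (p l : ℕ) : Set (ZMod (p ^ (8 * l + 1)) × ZMod (p ^ (8 * l + 1))) :=
  {x | 1 ≤ l ∧
    ¬ (p : ZMod (p ^ (8 * l + 1))) ^ (l + 1) ∣ x.1 ∧
    ¬ (p : ZMod (p ^ (8 * l + 1))) ^ (l + 1) ∣ x.2 ∧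
    ¬ (p : ZMod (p ^ (8 * l + 1))) ^ (l + 1) ∣ x.1 - x.2 ∧
    ¬ (p : ZMod (p ^ (8 * l + 1))) ^ (l + 1) ∣ G x.1 x.2 ∧
    ∃ t : Fin 5 → ZMod (p ^ (8 * l + 1)),
      (∃ i, ¬ (p : ZMod (p ^ (8 * l + 1))) ∣ t i) ∧
      Q1 (D : ZMod (p ^ (8 * l + 1))) t = 0 ∧
      Q2 (D : ZMod (p ^ (8 * l + 1))) x.1 x.2 t = 0}

/-- Reduction of residue classes modulo `p^(8(l+1)+1)` to residue classes modulo `p^(8l+1)`. -/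
def reduce (p l : ℕ) : ZMod (p ^ (8 * (l + 1) + 1)) →+* ZMod (p ^ (8 * l + 1)) :=
  ZMod.castHom (pow_dvd_pow p (by omega)) (ZMod (p ^ (8 * l + 1)))

/-- The set `𝓡*_{l+1}(p)` of those elements of `𝓡_{l+1}(p)` whose reduction modulo `p^(8l+1)`
is not in `𝓡_l(p)`. -/
def calRstarSucc (D : ℤ) (p l : ℕ) :
    Set (ZMod (p ^ (8 * (l + 1) + 1)) × ZMod (p ^ (8 * (l + 1) + 1))) :=
  {x | x ∈ calR D p (l + 1) ∧ (reduce p l x.1, reduce p l x.2) ∉ calR D p l}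

/-- The term `|𝓡*_{l+1}(p)| / p^(2(8(l+1)+1))`. -/
noncomputable def densityTerm (D : ℤ) (p l : ℕ) : ℝ :=
  ((calRstarSucc D p l).ncard : ℝ) / (p : ℝ) ^ (2 * (8 * (l + 1) + 1))

/-- The local factor `∑_{l ≥ 1} |𝓡*_l(p)| / p^(2(8l+1))` at `p`. -/
noncomputable def localFactor (D : ℤ) (p : ℕ) : ℝ :=
  ∑' l : ℕ, densityTerm D p l

/-- The constant `c_loc = 4 ∏_{p ∣ D} ∑_{l ≥ 1} |𝓡*_l(p)| / p^(2(8l+1))`. -/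
noncomputable def cloc (D : ℤ) : ℝ :=
  4 * ∏ p ∈ D.natAbs.primeFactors, localFactor D p

/-- The set of all `(A, B) ∈ ℤ_p²` such that `S^{(D;A,B)}` has a `ℚ_p`-rational point. -/
def solubleSet (D : ℤ) (p : ℕ) [Fact p.Prime] : Set (ℤ_[p] × ℤ_[p]) :=
  {x | (points (D : ℚ_[p]) (x.1 : ℚ_[p]) (x.2 : ℚ_[p])).Nonempty}

/-- The local density at `p`: the measure of the set of all `(A, B) ∈ ℤ_p²` such that
`S^{(D;A,B)}` has a `ℚ_p`-rational point, for the Haar measure on the Borel sets of `ℤ_p²`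
of total mass one. -/
noncomputable def localDensity (D : ℤ) (p : ℕ) [Fact p.Prime] : ENNReal :=
  letI : MeasurableSpace (ℤ_[p] × ℤ_[p]) := borel (ℤ_[p] × ℤ_[p])
  haveI : BorelSpace (ℤ_[p] × ℤ_[p]) := ⟨rfl⟩
  MeasureTheory.Measure.addHaarMeasure
    (⊤ : TopologicalSpace.PositiveCompacts (ℤ_[p] × ℤ_[p])) (solubleSet D p)

end BSDSurface

/-! Solubility is a condition only at the primes dividing `D`. Over `ℝ` and `ℚ_2` the number `D` is
a square, and for odd `p ∤ D` a case distinction on which of `D`, `-D`, `A`, `B`, `G(A,B)` are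
squares modulo `p` always produces a point (`points_nonempty_of_not_dvd`).

Let `p ∣ D`. A primitive solution modulo `p^(8l+1)` lifts to `ℤ_p` by Newton's method once some 2×2
minor of the Jacobian has valuation at most `4l`. If every minor were divisible by `p^(4l+1)`, then
`p^(l+1)` would divide one of `A`, `B`, `A - B`, `G(A,B)` (`exists_minor_not_dvd`). Hence `𝓡_l(p)`
describes exactly the soluble pairs for which `p^(l+1)` divides none of these four
(`reducePair_mem_calR_iff`). The excluded pairs lie modulo `p^(l+1)` on three lines and a conic, so
they have density at most `4/p^(l+1)`. The partial sums of `σ_p` are therefore measures of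
increasing sets that exhaust the soluble set up to measure zero (`hasSum_densityTerm`).

For the count, the Chinese remainder theorem merges the sets `𝓡_l(p)` into one condition modulo `M =
D^(8l+1)`. Counting residue classes in the box costs `O(NM + M²)`, and the excluded pairs together
with the truncation of `σ_p` cost `O(N²/3^l)` more (`abs_Rloc_sub_le`). Taking `l` proportional to
`log N` saves a power (`exists_power_saving`). Positivity holds because every pair with `p ∣ A` and
`p ∣ B` is soluble, whence `σ_p ≥ 1/p²`. -/

namespace BSDSurface

/-! ### Explicit points and squares in `ℤ_p`. -/

theorem points_nonempty_iff {K : Type*} [Field K] (D A B : K) :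
    (points D A B).Nonempty ↔ ∃ t : Fin 5 → K, t ≠ 0 ∧ Q1 D t = 0 ∧ Q2 D A B t = 0 := by
  constructor
  · rintro ⟨P, h1, h2⟩
    exact ⟨P.rep, P.rep_nonzero, h1, h2⟩
  · rintro ⟨t, ht, h1, h2⟩
    obtain ⟨a, ha⟩ := Projectivization.exists_smul_eq_mk_rep K t ht
    refine ⟨Projectivization.mk K t ht, ?_, ?_⟩
    · rw [← ha]
      have : Q1 D (a • t) = (a : K) ^ 2 * Q1 D t := by
        simp only [Q1, Pi.smul_apply, Units.smul_def, smul_eq_mul]; ring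
      rw [this, h1, mul_zero]
    · rw [← ha]
      have : Q2 D A B (a • t) = (a : K) ^ 2 * Q2 D A B t := by
        simp only [Q2, Pi.smul_apply, Units.smul_def, smul_eq_mul]; ring
      rw [this, h2, mul_zero]

theorem points_nonempty_of_coords {K : Type*} [Field K] {D A B : K} (t0 t1 t2 t3 t4 : K)
    (hne : t0 ≠ 0 ∨ t1 ≠ 0 ∨ t2 ≠ 0 ∨ t3 ≠ 0 ∨ t4 ≠ 0)
    (h1 : t2 ^ 2 - D * t3 ^ 2 = t0 * t1)
    (h2 : t2 ^ 2 - D * t4 ^ 2 = (t0 + A * t1) * (t0 + B * t1)) :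
    (points D A B).Nonempty := by
  refine (points_nonempty_iff D A B).2 ⟨![t0, t1, t2, t3, t4], ?_, ?_, ?_⟩
  · intro h
    have h0 := congrFun h 0
    have h1 := congrFun h 1
    have h2 := congrFun h 2
    have h3 := congrFun h 3
    have h4 := congrFun h 4
    simp at h0 h1 h2 h3 h4
    simp_all
  · simp only [Q1]; exact sub_eq_zero.2 h1
  · simp only [Q2]; exact sub_eq_zero.2 h2

theorem points_nonempty_of_isSquare {K : Type*} [Field K] {D : K} (A B : K) (h : IsSquare D) :
    (points D A B).Nonempty := by
  obtain ⟨s, rfl⟩ := h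
  exact points_nonempty_of_coords 0 0 s 1 1 (by simp) (by ring) (by ring)

theorem points_nonempty_of_isSquare_neg {K : Type*} [Field K] {D : K} (A B : K)
    (h : IsSquare (-D)) : (points D A B).Nonempty := by
  obtain ⟨s, hs⟩ := h
  refine points_nonempty_of_coords s 0 0 0 1 (by simp) (by ring) ?_
  linear_combination hs

theorem points_comm {K : Type*} [Field K] (D A B : K) : points D A B = points D B A := by
  ext P
  simp only [points, Set.mem_ofPred_eq, Q2]
  rw [mul_comm (P.rep 0 + A * P.rep 1)]

theorem points_nonempty_of_isSquare_mul {K : Type*} [Field K] {D A : K} (B : K) (hD : D ≠ 0)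
    (h : IsSquare (D * A)) : (points D A B).Nonempty := by
  obtain ⟨s, hs⟩ := h
  -- With `t0 = -A * t1` the right side of the second equation vanishes, so `t2 = t4 = 0` settles
  -- it.
  refine points_nonempty_of_coords (-A) 1 0 (s / D) 0 (by simp) ?_ (by ring)
  field_simp
  linear_combination hs

/-- The equation `y = D * t3 ^ 2` is solvable in `t3` iff `D * y` is a square. This form lets `t3`
and `t4` be found by Hensel lifting of squares. -/
theorem points_nonempty_of_isSquare_both {K : Type*} [Field K] {D A B : K} (t0 t1 x : K)
    (hD : D ≠ 0) (hne : t0 ≠ 0 ∨ t1 ≠ 0 ∨ x ≠ 0) (h1 : IsSquare (D * (x ^ 2 - t0 * t1)))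
    (h2 : IsSquare (D * (x ^ 2 - (t0 + A * t1) * (t0 + B * t1)))) :
    (points D A B).Nonempty := by
  obtain ⟨r, hr⟩ := h1
  obtain ⟨s, hs⟩ := h2
  refine points_nonempty_of_coords t0 t1 x (r / D) (s / D) (by tauto) ?_ ?_
  · field_simp
    linear_combination hr
  · field_simp
    linear_combination hs

open Polynomial in
theorem padicInt_isSquare_of_norm_lt {p : ℕ} [Fact p.Prime] (m a : ℤ_[p])
    (h : ‖a ^ 2 - m‖ < ‖2 * a‖ ^ 2) : IsSquare m := by
  obtain ⟨z, hz, -⟩ := hensels_lemma (F := (X ^ 2 - C m : ℤ_[p][X])) (a := a) (by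
    simpa [one_add_one_eq_two] using h)
  refine ⟨z, ?_⟩
  simp at hz
  linear_combination -hz

theorem padicInt_toZMod_eq_zero_iff {p : ℕ} [Fact p.Prime] (x : ℤ_[p]) :
    PadicInt.toZMod x = 0 ↔ ‖x‖ < 1 := by
  rw [← RingHom.mem_ker, PadicInt.ker_toZMod, IsLocalRing.mem_maximalIdeal, PadicInt.mem_nonunits]

theorem padicInt_norm_eq_one_of_toZMod {p : ℕ} [Fact p.Prime] {x : ℤ_[p]}
    (h : PadicInt.toZMod x ≠ 0) : ‖x‖ = 1 :=
  le_antisymm (PadicInt.norm_le_one x) (not_lt.1 ((padicInt_toZMod_eq_zero_iff x).not.1 h))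

theorem padicInt_isSquare_of_toZMod {p : ℕ} [Fact p.Prime] (hp : p ≠ 2) {m : ℤ_[p]}
    (h0 : PadicInt.toZMod m ≠ 0) (h : IsSquare (PadicInt.toZMod m)) : IsSquare m := by
  obtain ⟨s, hs⟩ := h
  obtain ⟨a, rfl⟩ := ZMod.ringHom_surjective (PadicInt.toZMod (p := p)) s
  have h2 : (2 : ZMod p) ≠ 0 := by
    have := ZMod.ringChar_zmod_n p
    exact Ring.two_ne_zero (by rw [this]; exact hp)
  refine padicInt_isSquare_of_norm_lt m a ?_
  rw [padicInt_norm_eq_one_of_toZMod (x := 2 * a), one_pow, ← padicInt_toZMod_eq_zero_iff]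
  · rw [map_sub, map_pow, hs]; ring
  · rw [map_mul]
    rw [map_ofNat]
    refine mul_ne_zero h2 ?_
    rintro h
    rw [h, mul_zero] at hs
    exact h0 hs

theorem padic_isSquare_intCast_of_zmod {p : ℕ} [Fact p.Prime] (hp : p ≠ 2) {m : ℤ}
    (h0 : (m : ZMod p) ≠ 0) (h : IsSquare (m : ZMod p)) : IsSquare (m : ℚ_[p]) := by
  have : IsSquare (m : ℤ_[p]) :=
    padicInt_isSquare_of_toZMod hp (by simpa using h0) (by simpa using h)
  simpa using this.map (PadicInt.Coe.ringHom (p := p))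

theorem padic_isSquare_intCast_two {D : ℤ} (hD : D ≡ 1 [ZMOD 8]) :
    IsSquare (D : ℚ_[2]) := by
  have : IsSquare (D : ℤ_[2]) := by
    -- Newton's criterion at `a = 1` reads `|1 - D| < |2|² = 1/4`, which is where `D ≡ 1` modulo `8`
    -- enters.
    refine padicInt_isSquare_of_norm_lt _ 1 ?_
    have h1 : ‖((1 - D : ℤ) : ℤ_[2])‖ ≤ (2 : ℕ) ^ (-(3 : ℕ) : ℤ) :=
      PadicInt.norm_int_le_pow_iff_dvd.2 (by simpa using hD.dvd)
    have h2 : ‖(2 : ℤ_[2])‖ = 2⁻¹ := by simpa using PadicInt.norm_p (p := 2)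
    push_cast at h1
    rw [one_pow, mul_one, h2]
    refine h1.trans_lt ?_
    norm_num
  simpa using this.map (PadicInt.Coe.ringHom (p := 2))

end BSDSurface

/-! ### Solubility over `ℝ` and at the primes not dividing `D`. -/

namespace BSDSurface

theorem isSquare_mul_of_not_isSquare {F : Type*} [Field F] [Fintype F] {a b : F}
    (ha : ¬ IsSquare a) (hb : ¬ IsSquare b) : IsSquare (a * b) := by
  classical
  by_cases h0 : a * b = 0
  · rw [h0]; exact IsSquare.zero
  · rw [← quadraticChar_one_iff_isSquare h0, map_mul,
      quadraticChar_neg_one_iff_not_isSquare.2 ha, quadraticChar_neg_one_iff_not_isSquare.2 hb]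
    norm_num

open Polynomial in
theorem exists_sq_sub_mul_sq_eq {F : Type*} [Field F] [Fintype F] (hF : Fintype.card F % 2 = 1)
    {m : F} (hm : m ≠ 0) (c : F) : ∃ s x : F, x ^ 2 - m * s ^ 2 = c := by
  obtain ⟨x, s, h⟩ := FiniteField.exists_root_sum_quadratic (R := F)
    (f := C 1 * X ^ 2 + C 0 * X + C (-c)) (g := C (-m) * X ^ 2 + C 0 * X + C 0)
    (degree_quadratic one_ne_zero) (degree_quadratic (neg_ne_zero.2 hm)) hF
  refine ⟨s, x, ?_⟩
  simp at h
  linear_combination h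

variable {p : ℕ} [Fact p.Prime]

/-- The nonvanishing hypotheses make the two quantities units, so that being a square modulo `p`
lifts to `ℤ_p`. -/
theorem points_nonempty_of_zmod (hp : p ≠ 2) {D A B : ℤ} (hD : (D : ZMod p) ≠ 0)
    (t0 t1 x : ZMod p)
    (h1 : (D : ZMod p) * (x ^ 2 - t0 * t1) ≠ 0)
    (h1' : IsSquare ((D : ZMod p) * (x ^ 2 - t0 * t1)))
    (h2 : (D : ZMod p) * (x ^ 2 - (t0 + A * t1) * (t0 + B * t1)) ≠ 0)
    (h2' : IsSquare ((D : ZMod p) * (x ^ 2 - (t0 + A * t1) * (t0 + B * t1)))) :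
    (points (D : ℚ_[p]) A B).Nonempty := by
  obtain ⟨t0, rfl⟩ := ZMod.intCast_surjective t0
  obtain ⟨t1, rfl⟩ := ZMod.intCast_surjective t1
  obtain ⟨x, rfl⟩ := ZMod.intCast_surjective x
  have e1 := padic_isSquare_intCast_of_zmod hp (m := D * (x ^ 2 - t0 * t1))
    (by push_cast; exact h1) (by push_cast; exact h1')
  have e2 := padic_isSquare_intCast_of_zmod hp (m := D * (x ^ 2 - (t0 + A * t1) * (t0 + B * t1)))
    (by push_cast; exact h2) (by push_cast; exact h2')
  push_cast at e1 e2
  refine points_nonempty_of_isSquare_both (t0 : ℚ_[p]) t1 x ?_ ?_ e1 e2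
  · rintro h
    have : D = 0 := by exact_mod_cast h
    simp [this] at hD
  · by_contra! h
    have e1 : t0 = 0 := by exact_mod_cast h.1
    have e2 : x = 0 := by exact_mod_cast h.2.2
    simp [e1, e2] at h1

theorem card_zmod_odd (hp : p ≠ 2) : Fintype.card (ZMod p) % 2 = 1 := by
  rw [ZMod.card]
  exact (Nat.Prime.mod_two_eq_one_iff_ne_two (Fact.out (p := p.Prime))).2 hp

theorem zmod_two_ne_zero (hp : p ≠ 2) : (2 : ZMod p) ≠ 0 :=
  Ring.two_ne_zero (by rw [ZMod.ringChar_zmod_n p]; exact hp)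

/-- The equation for `r` says `(r + A) * (r + B) = r`. On `t0 = r * t1` both right-hand sides thus
agree modulo `p`, and it suffices that the binary form `x² - r s²` represents `D`. -/
theorem points_nonempty_of_root (hp : p ≠ 2) {D A B : ℤ} (hD : (D : ZMod p) ≠ 0)
    {r : ZMod p} (hr : r ≠ 0) (h : r ^ 2 + (A + B - 1) * r + A * B = 0) :
    (points (D : ℚ_[p]) A B).Nonempty := by
  obtain ⟨s, x, hsx⟩ := exists_sq_sub_mul_sq_eq (card_zmod_odd hp) hr (D : ZMod p)
  have e1 : x ^ 2 - r * s * s = (D : ZMod p) := by rw [← hsx]; ring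
  have e2 : x ^ 2 - (r * s + A * s) * (r * s + B * s) = (D : ZMod p) := by
    linear_combination hsx - s ^ 2 * h
  refine points_nonempty_of_zmod hp hD (r * s) s x ?_ ?_ ?_ ?_
  · rw [e1]; exact mul_ne_zero hD hD
  · rw [e1]; exact ⟨_, rfl⟩
  · rw [e2]; exact mul_ne_zero hD hD
  · rw [e2]; exact ⟨_, rfl⟩

/-- For `A = α²`, `B = β²` one has `(t0 + A t1) (t0 + B t1) = (t0 - αβ t1)² + (α + β)² t0 t1`. If
`w² = 1 - (α + β)²`, the hyperplane `t0 = αβ t1 + w t2` makes the second equation `(α + β)²` times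
the first, with `t4 = (α + β) t3`. The first becomes a binary quadratic form in `t2`, `t1` of
discriminant `1 - (α - β)²`, which represents `D` modulo `p`. -/
theorem points_nonempty_of_sq (hp : p ≠ 2) {D : ℤ} (hD : (D : ZMod p) ≠ 0) (α β : ℤ_[p])
    (hw : IsSquare (1 - (α + β) ^ 2)) (hδ : PadicInt.toZMod (1 - (α - β) ^ 2) ≠ 0) :
    (points (D : ℚ_[p]) ((α : ℚ_[p]) ^ 2) ((β : ℚ_[p]) ^ 2)).Nonempty := by
  obtain ⟨w, hw⟩ := hw
  have h2 := zmod_two_ne_zero hp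
  obtain ⟨s, y, hsy⟩ := exists_sq_sub_mul_sq_eq (card_zmod_odd hp)
    (div_ne_zero hδ (pow_ne_zero 2 h2)) (D : ZMod p)
  obtain ⟨t, ht⟩ := ZMod.ringHom_surjective (PadicInt.toZMod (p := p)) s
  obtain ⟨x, hx⟩ := ZMod.ringHom_surjective (PadicInt.toZMod (p := p))
    (y + PadicInt.toZMod w * s / 2)
  have key : PadicInt.toZMod ((D : ℤ_[p]) * (x ^ 2 - (α * β * t + w * x) * t)) =
      (D : ZMod p) * (D : ZMod p) := by
    have hw' := congrArg (PadicInt.toZMod (p := p)) hw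
    simp only [map_mul, map_sub, map_pow, map_add, map_one, map_intCast, ht, hx] at hw' hsy ⊢
    congr 1
    rw [← hsy]
    field_simp
    linear_combination s ^ 2 * hw'
  have hDD : (D : ZMod p) * D ≠ 0 := mul_ne_zero hD hD
  obtain ⟨r, hr⟩ := padicInt_isSquare_of_toZMod hp (by rw [key]; exact hDD)
    (by rw [key]; exact ⟨_, rfl⟩)
  have hD0 : (D : ℚ_[p]) ≠ 0 := by
    rintro h
    have : D = 0 := by exact_mod_cast h
    simp [this] at hD
  have hr' : (D : ℚ_[p]) * (x ^ 2 - (α * β * t + w * x) * t) = r * r := by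
    simpa using congrArg ((↑) : ℤ_[p] → ℚ_[p]) hr
  have hw' : 1 - ((α : ℚ_[p]) + β) ^ 2 = w * w := by
    simpa using congrArg ((↑) : ℤ_[p] → ℚ_[p]) hw
  refine points_nonempty_of_isSquare_both (α * β * t + w * x : ℚ_[p]) t x hD0 ?_ ⟨r, hr'⟩
    ⟨(α + β) * r, ?_⟩
  · by_contra! h
    have e2 : t = 0 := PadicInt.coe_eq_zero.1 h.2.1
    have e3 : x = 0 := PadicInt.coe_eq_zero.1 h.2.2
    rw [e2, e3] at key
    simp at key
    simp [← key] at hD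
  · linear_combination (α + β : ℚ_[p]) ^ 2 * hr' + D * x ^ 2 * hw'

theorem points_nonempty_of_units (hp : p ≠ 2) {D A B : ℤ} (hD : ¬ IsSquare (D : ZMod p))
    (hA : (A : ZMod p) ≠ 0) (hB : (B : ZMod p) ≠ 0) : (points (D : ℚ_[p]) A B).Nonempty := by
  have hD0 : (D : ZMod p) ≠ 0 := fun h => hD (h ▸ IsSquare.zero)
  have hDQ : (D : ℚ_[p]) ≠ 0 := by
    rintro h
    have : D = 0 := by exact_mod_cast h
    simp [this] at hD0
  have h2 := zmod_two_ne_zero hp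
  by_cases hA' : IsSquare (A : ZMod p)
  swap
  · refine points_nonempty_of_isSquare_mul _ hDQ ?_
    simpa using padic_isSquare_intCast_of_zmod hp (m := D * A)
      (by push_cast; exact mul_ne_zero hD0 hA)
      (by push_cast; exact isSquare_mul_of_not_isSquare hD hA')
  by_cases hB' : IsSquare (B : ZMod p)
  swap
  · rw [points_comm]
    refine points_nonempty_of_isSquare_mul _ hDQ ?_
    simpa using padic_isSquare_intCast_of_zmod hp (m := D * B)
      (by push_cast; exact mul_ne_zero hD0 hB)
      (by push_cast; exact isSquare_mul_of_not_isSquare hD hB')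
  -- `G(A,B)` is the discriminant of `r² + (A + B - 1) r + A B`.
  by_cases hG : IsSquare (G (A : ZMod p) B)
  · obtain ⟨g, hg⟩ := hG
    have hq : ((g - (A + B - 1)) / 2) ^ 2 + (A + B - 1) * ((g - (A + B - 1)) / 2) + A * B
        = (0 : ZMod p) := by
      rw [G] at hg
      field_simp
      linear_combination -hg
    refine points_nonempty_of_root hp hD0 (r := (g - (A + B - 1)) / 2) ?_ hq
    intro h
    rw [h] at hq
    simp [hA, hB] at hq
  obtain ⟨α, hα⟩ := padicInt_isSquare_of_toZMod hp (m := (A : ℤ_[p])) (by simpa) (by simpa)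
  obtain ⟨β, hβ⟩ := padicInt_isSquare_of_toZMod hp (m := (B : ℤ_[p])) (by simpa) (by simpa)
  have hαA : (A : ℚ_[p]) = (α : ℚ_[p]) ^ 2 := by 
    simpa [pow_two] using congrArg ((↑) : ℤ_[p] → ℚ_[p]) hα
  have hβB : (B : ℚ_[p]) = (β : ℚ_[p]) ^ 2 := by 
    simpa [pow_two] using congrArg ((↑) : ℤ_[p] → ℚ_[p]) hβ
  have hGf : G (A : ZMod p) B =
      PadicInt.toZMod (1 - (α + β) ^ 2) * PadicInt.toZMod (1 - (α - β) ^ 2) := by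
    have h1 := congrArg (PadicInt.toZMod (p := p)) hα
    have h2 := congrArg (PadicInt.toZMod (p := p)) hβ
    simp only [map_intCast, map_mul] at h1 h2
    rw [h1, h2, G]
    simp only [map_sub, map_pow, map_add, map_one]
    ring
  have hne : PadicInt.toZMod (1 - (α + β) ^ 2) * PadicInt.toZMod (1 - (α - β) ^ 2) ≠ 0 := by
    rw [← hGf]
    exact fun h => hG (h ▸ IsSquare.zero)
  rw [hαA, hβB]
  by_cases h1 : IsSquare (PadicInt.toZMod (1 - (α + β) ^ 2))
  · exact points_nonempty_of_sq hp hD0 α β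
      (padicInt_isSquare_of_toZMod hp (left_ne_zero_of_mul hne) h1) (right_ne_zero_of_mul hne)
  · by_cases h3 : IsSquare (PadicInt.toZMod (1 - (α - β) ^ 2))
    -- Replacing `β` by `-β` keeps `B` and swaps the two factors of `G(A,B)`.
    · have := points_nonempty_of_sq hp hD0 α (-β)
        (by
          rw [← sub_eq_add_neg]
          exact padicInt_isSquare_of_toZMod hp (right_ne_zero_of_mul hne) h3)
        (by rw [sub_neg_eq_add]; exact left_ne_zero_of_mul hne)
      simpa using this
    · exact absurd (hGf ▸ isSquare_mul_of_not_isSquare h1 h3) hG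

theorem points_nonempty_of_dvd (hp : p ≠ 2) {D A B : ℤ} (hD : ¬ IsSquare (D : ZMod p))
    (hneg : IsSquare (-1 : ZMod p)) (hA : (A : ZMod p) = 0) :
    (points (D : ℚ_[p]) A B).Nonempty := by
  have hD0 : (D : ZMod p) ≠ 0 := fun h => hD (h ▸ IsSquare.zero)
  have h2 := zmod_two_ne_zero hp
  by_cases hB : (B : ZMod p) = 1
  · have ha : (1 + 1 / (D : ZMod p)) / 2 ≠ 0 := by
      intro h
      field_simp at h
      refine hD ?_
      rwa [show (D : ZMod p) = -1 by linear_combination h]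
    have hb : (1 - 1 / (D : ZMod p)) / 2 ≠ 0 := by
      intro h
      field_simp at h
      refine hD ?_
      rw [show (D : ZMod p) = 1 by linear_combination h]
      exact IsSquare.one
    have e1 : (D : ZMod p) * (0 ^ 2 - 1 * (-D * ((1 + 1 / (D : ZMod p)) / 2) ^ 2)) =
        (D * ((1 + 1 / (D : ZMod p)) / 2)) * (D * ((1 + 1 / (D : ZMod p)) / 2)) := by ring
    have e2 : (D : ZMod p) * (0 ^ 2 - (1 + A * (-D * ((1 + 1 / (D : ZMod p)) / 2) ^ 2)) *
        (1 + B * (-D * ((1 + 1 / (D : ZMod p)) / 2) ^ 2))) =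
        (D * ((1 - 1 / (D : ZMod p)) / 2)) * (D * ((1 - 1 / (D : ZMod p)) / 2)) := by
      rw [hA, hB]
      field_simp
      ring
    refine points_nonempty_of_zmod hp hD0 1 (-D * ((1 + 1 / (D : ZMod p)) / 2) ^ 2) 0 ?_ ?_ ?_ ?_
    · rw [e1]
      exact mul_ne_zero (mul_ne_zero hD0 ha) (mul_ne_zero hD0 ha)
    · rw [e1]; exact ⟨_, rfl⟩
    · rw [e2]
      exact mul_ne_zero (mul_ne_zero hD0 hb) (mul_ne_zero hD0 hb)
    · rw [e2]; exact ⟨_, rfl⟩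
  · refine points_nonempty_of_root hp hD0 (r := 1 - B) (sub_ne_zero.2 (Ne.symm hB)) ?_
    rw [hA]; ring

theorem points_nonempty_of_not_dvd {D : ℤ} (hD : D ≡ 1 [ZMOD 8]) (hpD : ¬ (p : ℤ) ∣ D)
    (A B : ℤ) : (points (D : ℚ_[p]) A B).Nonempty := by
  by_cases hp : p = 2
  · subst hp
    exact points_nonempty_of_isSquare _ _ (padic_isSquare_intCast_two hD)
  have hD0 : (D : ZMod p) ≠ 0 := by rwa [Ne, ZMod.intCast_zmod_eq_zero_iff_dvd]
  by_cases hsq : IsSquare (D : ZMod p)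
  · exact points_nonempty_of_isSquare _ _ (padic_isSquare_intCast_of_zmod hp hD0 hsq)
  -- If `-1` is a nonsquare like `D`, then `-D` is a square and there is an obvious point.
  by_cases hneg : IsSquare (-1 : ZMod p)
  · by_cases hA : (A : ZMod p) = 0
    · exact points_nonempty_of_dvd hp hsq hneg hA
    by_cases hB : (B : ZMod p) = 0
    · rw [points_comm]
      exact points_nonempty_of_dvd hp hsq hneg hB
    exact points_nonempty_of_units hp hsq hA hB
  · refine points_nonempty_of_isSquare_neg _ _ ?_
    simpa using padic_isSquare_intCast_of_zmod hp (m := -D) (by push_cast; exact neg_ne_zero.2 hD0)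
      (by
        push_cast
        rw [← neg_one_mul]
        exact isSquare_mul_of_not_isSquare hneg hsq)

theorem points_real_nonempty {D : ℤ} (hD : 0 < D) (A B : ℤ) :
    (points (D : ℝ) A B).Nonempty :=
  points_nonempty_of_isSquare _ _ ⟨√D, by
    rw [Real.mul_self_sqrt]; exact_mod_cast hD.le⟩

theorem everywhereLocallySoluble_iff {D : ℤ} (hpos : 0 < D) (hD : D ≡ 1 [ZMOD 8]) (A B : ℤ) :
    EverywhereLocallySoluble D A B ↔
      ∀ (p : ℕ) [Fact p.Prime], (p : ℤ) ∣ D → ((A : ℤ_[p]), (B : ℤ_[p])) ∈ solubleSet D p := by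
  constructor
  · rintro ⟨-, h⟩ p _ -
    simpa [solubleSet] using h p
  · intro h
    refine ⟨points_real_nonempty hpos A B, fun p _ => ?_⟩
    by_cases hp : (p : ℤ) ∣ D
    · simpa [solubleSet] using h p hp
    · exact points_nonempty_of_not_dvd hD hp A B

end BSDSurface

/-! ### Newton lifting and Jacobian minors at the primes dividing `D`. -/

namespace BSDSurface

/-- The gradient of `Q1`. -/
def gradQ1 {R : Type*} [CommRing R] (D : R) (t : Fin 5 → R) : Fin 5 → R :=
  ![-t 1, -t 0, 2 * t 2, -(2 * D * t 3), 0]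

/-- The gradient of `Q2`. -/
def gradQ2 {R : Type*} [CommRing R] (D A B : R) (t : Fin 5 → R) : Fin 5 → R :=
  ![-(2 * t 0 + (A + B) * t 1), -((A + B) * t 0 + 2 * (A * B) * t 1), 2 * t 2, 0,
    -(2 * D * t 4)]

/-- The minor of the Jacobian matrix of `(Q1, Q2)` with columns `i` and `j`. -/
def minor {R : Type*} [CommRing R] (D A B : R) (i j : Fin 5) (t : Fin 5 → R) : R :=
  gradQ1 D t i * gradQ2 D A B t j - gradQ1 D t j * gradQ2 D A B t i

section Taylor

variable {R : Type*} [CommRing R] (D A B c : R) (t h : Fin 5 → R)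

theorem Q1_add : Q1 D (t + h) = Q1 D t + gradQ1 D t ⬝ᵥ h + Q1 D h := by
  simp only [Q1, gradQ1, dotProduct, Fin.sum_univ_five, Pi.add_apply]
  simp
  ring

theorem Q2_add : Q2 D A B (t + h) = Q2 D A B t + gradQ2 D A B t ⬝ᵥ h + Q2 D A B h := by
  simp only [Q2, gradQ2, dotProduct, Fin.sum_univ_five, Pi.add_apply]
  simp
  ring

theorem Q1_smul : Q1 D (c • h) = c ^ 2 * Q1 D h := by
  simp only [Q1, Pi.smul_apply, smul_eq_mul]
  ring

theorem Q2_smul : Q2 D A B (c • h) = c ^ 2 * Q2 D A B h := by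
  simp only [Q2, Pi.smul_apply, smul_eq_mul]
  ring

theorem gradQ1_add_smul : gradQ1 D (t + c • h) = gradQ1 D t + c • gradQ1 D h := by
  ext i
  fin_cases i <;> simp [gradQ1] <;> ring

theorem gradQ2_add_smul : gradQ2 D A B (t + c • h) = gradQ2 D A B t + c • gradQ2 D A B h := by
  ext i
  fin_cases i <;> simp [gradQ2] <;> ring

theorem dvd_minor_add_smul_sub (i j : Fin 5) :
    c ∣ minor D A B i j (t + c • h) - minor D A B i j t := by
  simp only [minor, gradQ1_add_smul, gradQ2_add_smul, Pi.add_apply, Pi.smul_apply, smul_eq_mul]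
  refine ⟨gradQ1 D t i * gradQ2 D A B h j + gradQ1 D h i * gradQ2 D A B t j +
    c * gradQ1 D h i * gradQ2 D A B h j - (gradQ1 D t j * gradQ2 D A B h i +
      gradQ1 D h j * gradQ2 D A B t i + c * gradQ1 D h j * gradQ2 D A B h i), ?_⟩
  ring

end Taylor

variable {p : ℕ} [Fact p.Prime]

/-- One step of Newton's method for the system `Q1 = Q2 = 0` in two of the coordinates. -/
theorem exists_newton_step (D A B : ℤ_[p]) {i j : Fin 5} {k n : ℕ} (hkn : 2 * k + 1 ≤ n)
    {t : Fin 5 → ℤ_[p]} (hprim : ∃ i, ¬ (p : ℤ_[p]) ∣ t i)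
    (hm : ∃ u : ℤ_[p]ˣ, minor D A B i j t = p ^ k * u)
    (h1 : (p : ℤ_[p]) ^ n ∣ Q1 D t) (h2 : (p : ℤ_[p]) ^ n ∣ Q2 D A B t) :
    ∃ t' : Fin 5 → ℤ_[p], (∃ i, ¬ (p : ℤ_[p]) ∣ t' i) ∧
      (∃ u : ℤ_[p]ˣ, minor D A B i j t' = p ^ k * u) ∧
      (p : ℤ_[p]) ^ (n + 1) ∣ Q1 D t' ∧ (p : ℤ_[p]) ^ (n + 1) ∣ Q2 D A B t' := by
  obtain ⟨u, hu⟩ := hm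
  obtain ⟨q1, hq1⟩ := h1
  obtain ⟨q2, hq2⟩ := h2
  set π : ℤ_[p] := (p : ℤ_[p]) with hπ
  obtain ⟨m, rfl⟩ : ∃ m, n = 2 * k + 1 + m := ⟨n - (2 * k + 1), by omega⟩
  -- Cramer's rule in the columns `i`, `j`: as the minor is `p^k` times a unit, the right-hand side
  -- `-p^k (q1, q2)` has an integral solution.
  set x : ℤ_[p] := ↑u⁻¹ * (gradQ1 D t j * q2 - gradQ2 D A B t j * q1) with hx
  set y : ℤ_[p] := ↑u⁻¹ * (gradQ2 D A B t i * q1 - gradQ1 D t i * q2) with hy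
  set s : Fin 5 → ℤ_[p] := Pi.single i x + Pi.single j y with hs
  have huu : (u : ℤ_[p]) * ↑u⁻¹ = 1 := by simp
  have hd1 : gradQ1 D t ⬝ᵥ s = -(π ^ k * q1) := by
    rw [hs, dotProduct_add, dotProduct_single, dotProduct_single, hx, hy]
    rw [minor] at hu
    linear_combination (-(↑u⁻¹) * q1) * hu - π ^ k * q1 * huu
  have hd2 : gradQ2 D A B t ⬝ᵥ s = -(π ^ k * q2) := by
    rw [hs, dotProduct_add, dotProduct_single, dotProduct_single, hx, hy]
    rw [minor] at hu
    linear_combination (-(↑u⁻¹) * q2) * hu - π ^ k * q2 * huu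
  -- The linear term is `-p^n q`, cancelling the old value. The quadratic term is divisible by
  -- `p^(2(k+1+m))`, hence by `p^(n+1)`. The minor changes by a multiple of `p^(k+1)`, so its
  -- valuation stays `k`.
  refine ⟨t + π ^ (k + 1 + m) • s, ?_, ?_, ?_, ?_⟩
  · obtain ⟨a, ha⟩ := hprim
    refine ⟨a, fun h => ha ?_⟩
    rw [Pi.add_apply, Pi.smul_apply, smul_eq_mul] at h
    exact (dvd_add_left ((dvd_pow_self π (by omega)).mul_right _)).1 h
  · obtain ⟨e, he⟩ := dvd_minor_add_smul_sub D A B (π ^ (k + 1 + m)) t s i j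
    have hunit : IsUnit ((u : ℤ_[p]) + π ^ (m + 1) * e) := by
      rw [PadicInt.isUnit_iff]
      refine le_antisymm (PadicInt.norm_le_one _) (not_lt.1 fun h => ?_)
      rw [PadicInt.norm_lt_one_iff_dvd] at h
      have h' : π ∣ (u : ℤ_[p]) :=
        (dvd_add_left ((dvd_pow_self π (by omega)).mul_right _)).1 h
      exact PadicInt.p_nonunit (isUnit_of_dvd_unit h' u.isUnit)
    refine ⟨hunit.unit, ?_⟩
    rw [IsUnit.unit_spec, eq_add_of_sub_eq he, hu]
    ring
  · rw [Q1_add, Q1_smul, hq1, dotProduct_smul, hd1, smul_eq_mul]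
    exact ⟨π ^ m * Q1 D s, by ring⟩
  · rw [Q2_add, Q2_smul, hq2, dotProduct_smul, hd2, smul_eq_mul]
    exact ⟨π ^ m * Q2 D A B s, by ring⟩

theorem exists_primitive_dvd_of_minor (D A B : ℤ_[p]) {i j : Fin 5} {k n : ℕ}
    (hkn : 2 * k + 1 ≤ n) {t : Fin 5 → ℤ_[p]} (hprim : ∃ i, ¬ (p : ℤ_[p]) ∣ t i)
    (hm : ¬ (p : ℤ_[p]) ^ (k + 1) ∣ minor D A B i j t)
    (h1 : (p : ℤ_[p]) ^ n ∣ Q1 D t) (h2 : (p : ℤ_[p]) ^ n ∣ Q2 D A B t) (N : ℕ) :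
    ∃ t' : Fin 5 → ℤ_[p], (∃ i, ¬ (p : ℤ_[p]) ∣ t' i) ∧
      (p : ℤ_[p]) ^ N ∣ Q1 D t' ∧ (p : ℤ_[p]) ^ N ∣ Q2 D A B t' := by
  have hne : minor D A B i j t ≠ 0 := fun h => hm (h ▸ dvd_zero _)
  set k' := (minor D A B i j t).valuation with hk'
  have hspec : minor D A B i j t = p ^ k' * PadicInt.unitCoeff hne := by
    rw [mul_comm]; exact PadicInt.unitCoeff_spec hne
  have hkk : k' ≤ k := by
    by_contra! h
    exact hm (hspec ▸ (pow_dvd_pow _ h).mul_right _)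
  have main : ∀ r : ℕ, ∃ t' : Fin 5 → ℤ_[p], (∃ i, ¬ (p : ℤ_[p]) ∣ t' i) ∧
      (∃ u : ℤ_[p]ˣ, minor D A B i j t' = p ^ k' * u) ∧
      (p : ℤ_[p]) ^ (n + r) ∣ Q1 D t' ∧ (p : ℤ_[p]) ^ (n + r) ∣ Q2 D A B t' := by
    intro r
    induction r with
    | zero => exact ⟨t, hprim, ⟨_, hspec⟩, h1, h2⟩
    | succ r ih =>
      obtain ⟨t', a, b, c, d⟩ := ih
      exact exists_newton_step (n := n + r) D A B (by omega) a b c d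
  obtain ⟨t', a, -, c, d⟩ := main N
  exact ⟨t', a, (pow_dvd_pow _ (by omega)).trans c, (pow_dvd_pow _ (by omega)).trans d⟩

theorem padicInt_norm_le_of_dvd {x : ℤ_[p]} {n : ℕ} (h : (p : ℤ_[p]) ^ n ∣ x) :
    ‖x‖ ≤ (p : ℝ) ^ (-n : ℤ) :=
  (PadicInt.norm_le_pow_iff_mem_span_pow x n).2 (Ideal.mem_span_singleton.2 h)

/-- Primitive vectors form a compact set, on which `‖Q1‖ + ‖Q2‖` attains its minimum. Arbitrarily
good approximate zeros force that minimum to be `0`. -/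
theorem exists_primitive_zero (D A B : ℤ_[p])
    (h : ∀ N : ℕ, ∃ t : Fin 5 → ℤ_[p], (∃ i, ¬ (p : ℤ_[p]) ∣ t i) ∧
      (p : ℤ_[p]) ^ N ∣ Q1 D t ∧ (p : ℤ_[p]) ^ N ∣ Q2 D A B t) :
    ∃ t : Fin 5 → ℤ_[p], (∃ i, ¬ (p : ℤ_[p]) ∣ t i) ∧ Q1 D t = 0 ∧ Q2 D A B t = 0 := by
  set K : Set (Fin 5 → ℤ_[p]) := {t | ∃ i, ¬ (p : ℤ_[p]) ∣ t i} with hK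
  have hclosed : IsClosed K := by
    have : K = ⋃ i, {t : Fin 5 → ℤ_[p] | 1 ≤ ‖t i‖} := by
      ext t
      simp [hK, ← PadicInt.norm_lt_one_iff_dvd]
    rw [this]
    exact isClosed_iUnion_of_finite fun i =>
      isClosed_le continuous_const (continuous_apply i).norm
  obtain ⟨t0, ht0, -⟩ := h 0
  obtain ⟨t, htK, hmin⟩ := hclosed.isCompact.exists_isMinOn
    (f := fun t : Fin 5 → ℤ_[p] => ‖Q1 D t‖ + ‖Q2 D A B t‖) ⟨t0, ht0⟩
    (by unfold Q1 Q2; fun_prop)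
  have hle : ‖Q1 D t‖ + ‖Q2 D A B t‖ ≤ 0 := by
    by_contra! hpos
    obtain ⟨N, hN⟩ := PadicInt.exists_pow_neg_lt p (half_pos hpos)
    obtain ⟨t', ht', h1, h2⟩ := h N
    have := isMinOn_iff.1 hmin t' ht'
    have h1' := padicInt_norm_le_of_dvd h1
    have h2' := padicInt_norm_le_of_dvd h2
    linarith
  have n1 := norm_nonneg (Q1 D t)
  have n2 := norm_nonneg (Q2 D A B t)
  exact ⟨t, htK, norm_eq_zero.1 (by linarith), norm_eq_zero.1 (by linarith)⟩

theorem mem_solubleSet_iff (D : ℤ) (x : ℤ_[p] × ℤ_[p]) :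
    x ∈ solubleSet D p ↔ ∃ t : Fin 5 → ℤ_[p], (∃ i, ¬ (p : ℤ_[p]) ∣ t i) ∧
      Q1 (D : ℤ_[p]) t = 0 ∧ Q2 (D : ℤ_[p]) x.1 x.2 t = 0 := by
  change (points (D : ℚ_[p]) (x.1 : ℚ_[p]) (x.2 : ℚ_[p])).Nonempty ↔ _
  rw [points_nonempty_iff]
  constructor
  · rintro ⟨t, ht, h1, h2⟩
    -- Dividing by a coordinate of largest norm gives an integral primitive vector.
    obtain ⟨i, hi⟩ := Finite.exists_max fun i => ‖t i‖
    have hti : t i ≠ 0 := by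
      intro h0
      refine ht (funext fun j => ?_)
      have := hi j
      rw [h0, norm_zero] at this
      simpa using this
    have hle : ∀ j, ‖(t i)⁻¹ * t j‖ ≤ 1 := by
      intro j
      rw [norm_mul, norm_inv, inv_mul_le_one₀ (norm_pos_iff.2 hti)]
      exact hi j
    obtain ⟨s, hs⟩ : ∃ s : Fin 5 → ℤ_[p], ∀ j, (s j : ℚ_[p]) = (t i)⁻¹ * t j :=
      ⟨fun j => ⟨(t i)⁻¹ * t j, hle j⟩, fun j => rfl⟩
    refine ⟨s, ⟨i, ?_⟩, ?_, ?_⟩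
    · rw [← PadicInt.norm_lt_one_iff_dvd, not_lt, PadicInt.norm_def, hs, inv_mul_cancel₀ hti,
        norm_one]
    · rw [← PadicInt.coe_eq_zero]
      have := Q1_smul (D : ℚ_[p]) (t i)⁻¹ t
      rw [h1, mul_zero] at this
      simpa [Q1, hs] using this
    · rw [← PadicInt.coe_eq_zero]
      have := Q2_smul (D : ℚ_[p]) (x.1 : ℚ_[p]) x.2 (t i)⁻¹ t
      rw [h2, mul_zero] at this
      simpa [Q2, hs] using this
  · rintro ⟨t, ⟨i, hi⟩, h1, h2⟩
    refine ⟨fun j => (t j : ℚ_[p]), ?_, ?_, ?_⟩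
    · intro h0
      have : t i = 0 := PadicInt.coe_eq_zero.1 (congrFun h0 i)
      exact hi (this ▸ dvd_zero _)
    · simpa [Q1] using congrArg ((↑) : ℤ_[p] → ℚ_[p]) h1
    · simpa [Q2] using congrArg ((↑) : ℤ_[p] → ℚ_[p]) h2

theorem pow_dvd_left_of_pow_dvd_mul {R : Type*} [CommRing R] [IsDomain R] {π : R}
    (hπ : Prime π) {k : ℕ} :
    ∀ {n : ℕ} {x y : R}, ¬ π ^ (k + 1) ∣ y → π ^ (n + k) ∣ x * y → π ^ n ∣ x := by
  induction k with
  | zero =>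
    intro n x y hy h
    exact hπ.pow_dvd_of_dvd_mul_right n (by simpa using hy) h
  | succ k ih =>
    intro n x y hy h
    by_cases hy' : π ∣ y
    · obtain ⟨z, rfl⟩ := hy'
      refine ih (y := z) (fun hz => hy ?_) ?_
      · rw [pow_succ', mul_comm π]
        rw [mul_comm]
        exact mul_dvd_mul_left π hz
      · rw [← add_assoc, pow_succ', mul_left_comm] at h
        exact (mul_dvd_mul_iff_left hπ.ne_zero).1 h
    · exact (pow_dvd_pow _ (by omega)).trans (hπ.pow_dvd_of_dvd_mul_right _ hy' h)

theorem padicInt_two_not_dvd (hp : p ≠ 2) : ¬ (p : ℤ_[p]) ∣ 2 := by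
  rw [← PadicInt.norm_lt_one_iff_dvd, ← padicInt_toZMod_eq_zero_iff, map_ofNat]
  exact zmod_two_ne_zero hp

/-- At a primitive approximate zero of `(Q1, Q2)` some minor of the Jacobian matrix has small
valuation, unless one of `A`, `B`, `A - B`, `G(A, B)` is divisible by a high power of `p`. -/
theorem exists_minor_not_dvd (hp : p ≠ 2) {D A B d : ℤ_[p]} (hD : D = p * d)
    (hd : ¬ (p : ℤ_[p]) ∣ d) {l : ℕ} (hl : 1 ≤ l) (hA : ¬ (p : ℤ_[p]) ^ (l + 1) ∣ A)
    (hB : ¬ (p : ℤ_[p]) ^ (l + 1) ∣ B)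
    (hAB : ¬ (p : ℤ_[p]) ^ (l + 1) ∣ A - B) (hG : ¬ (p : ℤ_[p]) ^ (l + 1) ∣ G A B)
    {t : Fin 5 → ℤ_[p]} (hprim : ∃ i, ¬ (p : ℤ_[p]) ∣ t i)
    (h1 : (p : ℤ_[p]) ^ (8 * l + 1) ∣ Q1 D t) (h2 : (p : ℤ_[p]) ^ (8 * l + 1) ∣ Q2 D A B t) :
    ∃ i j, ¬ (p : ℤ_[p]) ^ (4 * l + 1) ∣ minor D A B i j t := by
  set π : ℤ_[p] := (p : ℤ_[p]) with hπdef
  have hπ : Prime π := PadicInt.prime_p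
  have h2' : ¬ π ∣ 2 := padicInt_two_not_dvd hp
  by_contra! hall
  have hlow {n m : ℕ} {x : ℤ_[p]} (hnm : m ≤ n) (h : π ^ n ∣ x) : π ^ m ∣ x :=
    (pow_dvd_pow _ hnm).trans h
  have cancel2 {n : ℕ} {x : ℤ_[p]} (h : π ^ n ∣ x * 2) : π ^ n ∣ x :=
    hπ.pow_dvd_of_dvd_mul_right n h2' h
  have m01 : π ^ (4 * l + 1) ∣ A * B * t 1 ^ 2 - t 0 ^ 2 := by
    refine cancel2 ((hall 0 1).trans (Dvd.intro 1 ?_))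
    simp [minor, gradQ1, gradQ2]; ring
  have hπD : π ∣ D := ⟨d, hD⟩
  -- If `p ∣ t 1`, the minor 01 gives `p ∣ t 0`, then `p ∣ t 2`. Since `D` has valuation exactly
  -- `1`, also `t 3` and `t 4` are divisible, against primitivity.
  have ht1 : ¬ π ∣ t 1 := by
    intro ht1
    have ht0 : π ∣ t 0 := by
      refine hπ.dvd_of_dvd_pow (n := 2) ?_
      have e : t 0 ^ 2 = A * B * t 1 * t 1 - (A * B * t 1 ^ 2 - t 0 ^ 2) := by ring
      rw [e]
      exact dvd_sub (ht1.mul_left _) ((dvd_pow_self π (by omega)).trans m01)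
    have ht2 : π ∣ t 2 := by
      refine hπ.dvd_of_dvd_pow (n := 2) ?_
      have e : t 2 ^ 2 = Q1 D t + D * t 3 ^ 2 + t 0 * t 1 := by simp only [Q1]; ring
      rw [e]
      exact dvd_add (dvd_add ((dvd_pow_self π (by omega)).trans h1) (hπD.mul_right _))
        (ht1.mul_left _)
    have key : ∀ x : ℤ_[p], π ^ 2 ∣ D * x ^ 2 → π ∣ x := by
      intro x hx
      rw [hD, pow_two, mul_assoc] at hx
      have := (mul_dvd_mul_iff_left hπ.ne_zero).1 hx
      exact hπ.dvd_of_dvd_pow ((hπ.dvd_or_dvd this).resolve_left hd)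
    have ht3 : π ∣ t 3 := by
      refine key _ ?_
      have e : D * t 3 ^ 2 = t 2 ^ 2 - t 0 * t 1 - Q1 D t := by simp only [Q1]; ring
      rw [e]
      exact dvd_sub (dvd_sub (pow_dvd_pow_of_dvd ht2 2) (pow_two π ▸ mul_dvd_mul ht0 ht1))
        (hlow (by omega) h1)
    have ht4 : π ∣ t 4 := by
      refine key _ ?_
      have e : D * t 4 ^ 2 = t 2 ^ 2 - (t 0 + A * t 1) * (t 0 + B * t 1) - Q2 D A B t := by
        simp only [Q2]; ring
      rw [e]
      exact dvd_sub (dvd_sub (pow_dvd_pow_of_dvd ht2 2) (pow_two π ▸ mul_dvd_mul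
        (dvd_add ht0 (ht1.mul_left _)) (dvd_add ht0 (ht1.mul_left _)))) (hlow (by omega) h2)
    obtain ⟨i, hi⟩ := hprim
    fin_cases i
    · exact hi ht0
    · exact hi ht1
    · exact hi ht2
    · exact hi ht3
    · exact hi ht4
  have cancel1 {n : ℕ} {x : ℤ_[p]} (h : π ^ n ∣ x * t 1) : π ^ n ∣ x :=
    hπ.pow_dvd_of_dvd_mul_right n ht1 h
  have cancelD {n : ℕ} {x : ℤ_[p]} (h : π ^ (n + 1) ∣ x * D) : π ^ n ∣ x := by
    rw [hD, pow_succ', mul_left_comm] at h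
    exact hπ.pow_dvd_of_dvd_mul_right n hd ((mul_dvd_mul_iff_left hπ.ne_zero).1 h)
  have m03 := hall 0 3
  have m13 := hall 1 3
  have m02 := hall 0 2
  have m12 := hall 1 2
  -- Eliminating `t 0` from the minors 03 and 13 leaves `D * t 3` times `(A + B)² - 4AB = (A - B)²`,
  -- up to the units `2` and `t 1`. Cancelling `D` costs one power of `p`, the square at most `2l`.
  have ht3 : π ^ (2 * l) ∣ t 3 := by
    have hdvd : π ^ (4 * l + 1) ∣ t 3 * (A - B) * (A - B) * D := by
      refine cancel2 (cancel1 ?_)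
      have e : t 3 * (A - B) * (A - B) * D * 2 * t 1 =
          -((A + B) * minor D A B 0 3 t - 2 * minor D A B 1 3 t) := by
        simp [minor, gradQ1, gradQ2]; ring
      rw [e]
      exact (dvd_sub (m03.mul_left _) (m13.mul_left _)).neg_right
    have := cancelD hdvd
    rw [show 4 * l = 2 * l + l + l by ring] at this
    exact pow_dvd_left_of_pow_dvd_mul hπ hAB (pow_dvd_left_of_pow_dvd_mul hπ hAB this)
  -- The same elimination with the minors 02 and 12 gives the factor `(A + B - 1)² - 4AB = G(A,B)`,
  -- which costs at most `l` powers.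
  have ht2 : π ^ (3 * l + 1) ∣ t 2 := by
    have hdvd : π ^ (4 * l + 1) ∣ t 2 * G A B := by
      refine cancel2 (cancel1 ?_)
      have e : t 2 * G A B * 2 * t 1 =
          (A + B - 1) * minor D A B 0 2 t - 2 * minor D A B 1 2 t := by
        simp [minor, gradQ1, gradQ2, G]; ring
      rw [e]
      exact dvd_sub (m02.mul_left _) (m12.mul_left _)
    rw [show 4 * l + 1 = 3 * l + 1 + l by ring] at hdvd
    exact pow_dvd_left_of_pow_dvd_mul hπ hG hdvd
  have ht0 : π ^ (4 * l + 1) ∣ t 0 := by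
    refine cancel1 ?_
    have e : t 0 * t 1 = t 2 * t 2 - D * (t 3 * t 3) - Q1 D t := by simp only [Q1]; ring
    rw [e]
    refine dvd_sub (dvd_sub (hlow (n := 3 * l + 1 + (3 * l + 1)) (by omega) ?_) ?_)
      (hlow (by omega) h1)
    · rw [pow_add]; exact mul_dvd_mul ht2 ht2
    · rw [show 4 * l + 1 = 1 + (2 * l + 2 * l) by ring, pow_add, pow_add, pow_one]
      exact mul_dvd_mul hπD (mul_dvd_mul ht3 ht3)
  -- With `t 0` negligible, the minor 01 bounds `A * B`. As `A` absorbs at most `l` powers, `3l + 1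
  -- ≥ l + 1` remain for `B`, a contradiction.
  have hAB' : π ^ (4 * l + 1) ∣ B * A := by
    refine cancel1 (cancel1 ?_)
    have e : B * A * t 1 * t 1 = (A * B * t 1 ^ 2 - t 0 ^ 2) + t 0 * t 0 := by ring
    rw [e]
    exact dvd_add m01 (ht0.mul_right _)
  rw [show 4 * l + 1 = 3 * l + 1 + l by ring] at hAB'
  exact hB (hlow (by omega) (pow_dvd_left_of_pow_dvd_mul hπ hA hAB'))

end BSDSurface

/-! ### Residue classes modulo prime powers and the exceptional pairs. -/

namespace BSDSurface

/-- The pairs `(A, B)` such that `q` divides one of `A`, `B`, `A - B`, `G(A, B)`. -/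
def badSet {R : Type*} [CommRing R] (q : R) : Set (R × R) :=
  {x | q ∣ x.1 ∨ q ∣ x.2 ∨ q ∣ x.1 - x.2 ∨ q ∣ G x.1 x.2}

theorem map_G {R S : Type*} [CommRing R] [CommRing S] (f : R →+* S) (A B : R) :
    f (G A B) = G (f A) (f B) := by
  simp [G, map_ofNat f 2]

theorem map_Q1 {R S : Type*} [CommRing R] [CommRing S] (f : R →+* S) (D : R) (t : Fin 5 → R) :
    f (Q1 D t) = Q1 (f D) (fun i => f (t i)) := by
  simp [Q1]

theorem map_Q2 {R S : Type*} [CommRing R] [CommRing S] (f : R →+* S) (D A B : R)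
    (t : Fin 5 → R) : f (Q2 D A B t) = Q2 (f D) (f A) (f B) (fun i => f (t i)) := by
  simp [Q2]

section Reduction

variable {p : ℕ} [Fact p.Prime]

theorem toZModPow_eq_zero_iff {n : ℕ} (x : ℤ_[p]) :
    PadicInt.toZModPow n x = 0 ↔ (p : ℤ_[p]) ^ n ∣ x := by
  rw [← RingHom.mem_ker, PadicInt.ker_toZModPow, Ideal.mem_span_singleton]

theorem pow_dvd_toZModPow_iff {m n : ℕ} (hmn : m ≤ n) (x : ℤ_[p]) :
    (p : ZMod (p ^ n)) ^ m ∣ PadicInt.toZModPow n x ↔ (p : ℤ_[p]) ^ m ∣ x := by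
  constructor
  · rintro ⟨y, hy⟩
    obtain ⟨y, rfl⟩ := ZMod.ringHom_surjective (PadicInt.toZModPow (p := p) n) y
    have h : PadicInt.toZModPow n (x - (p : ℤ_[p]) ^ m * y) = 0 := by
      rw [map_sub, map_mul, map_pow, map_natCast, hy, sub_self]
    rw [toZModPow_eq_zero_iff] at h
    exact (dvd_iff_dvd_of_dvd_sub ((pow_dvd_pow _ hmn).trans h)).2 (dvd_mul_right _ _)
  · intro h
    simpa using map_dvd (PadicInt.toZModPow (p := p) n) h

/-- Reduction of a pair of `p`-adic integers modulo `p ^ n`. -/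
noncomputable def reducePair (p : ℕ) [Fact p.Prime] (n : ℕ) (x : ℤ_[p] × ℤ_[p]) :
    ZMod (p ^ n) × ZMod (p ^ n) :=
  (PadicInt.toZModPow n x.1, PadicInt.toZModPow n x.2)

theorem reducePair_mem_badSet_iff {m : ℕ} (x : ℤ_[p] × ℤ_[p]) :
    reducePair p m x ∈ badSet (0 : ZMod (p ^ m)) ↔ x ∈ badSet ((p : ℤ_[p]) ^ m) := by
  simp only [badSet, reducePair, Set.mem_ofPred_eq, zero_dvd_iff, ← map_sub, ← map_G,
    toZModPow_eq_zero_iff]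

theorem exists_eq_mul_of_squarefree {D : ℤ} (hsq : Squarefree D) (hpD : (p : ℤ) ∣ D) :
    ∃ d : ℤ_[p], (D : ℤ_[p]) = p * d ∧ ¬ (p : ℤ_[p]) ∣ d := by
  obtain ⟨d, rfl⟩ := hpD
  refine ⟨d, by push_cast; rfl, fun h => ?_⟩
  have h' := (PadicInt.pow_p_dvd_int_iff 1 d).1 (by simpa using h)
  rw [pow_one] at h'
  have := hsq p (mul_dvd_mul_left _ h')
  rw [Int.isUnit_iff] at this
  have hp2 := (Fact.out (p := p.Prime)).two_le
  omega

/-- The exponent `8l + 1 = 2 * (4l) + 1` is just what Newton's method needs for a minor of valuation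
at most `4l`. -/
theorem reducePair_mem_calR_iff (hp : p ≠ 2) {D : ℤ} (hsq : Squarefree D) (hpD : (p : ℤ) ∣ D)
    {l : ℕ} (hl : 1 ≤ l) (x : ℤ_[p] × ℤ_[p]) :
    reducePair p (8 * l + 1) x ∈ calR D p l ↔
      x ∈ solubleSet D p ∧ x ∉ badSet ((p : ℤ_[p]) ^ (l + 1)) := by
  have hdvd (y : ℤ_[p]) : (p : ZMod (p ^ (8 * l + 1))) ^ (l + 1) ∣
      PadicInt.toZModPow (8 * l + 1) y ↔ (p : ℤ_[p]) ^ (l + 1) ∣ y :=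
    pow_dvd_toZModPow_iff (by omega) y
  have hdvd1 (y : ℤ_[p]) : (p : ZMod (p ^ (8 * l + 1))) ∣
      PadicInt.toZModPow (8 * l + 1) y ↔ (p : ℤ_[p]) ∣ y := by
    simpa using pow_dvd_toZModPow_iff (m := 1) (n := 8 * l + 1) (by omega) y
  simp only [calR, reducePair, badSet, Set.mem_ofPred_eq, ← map_sub, ← map_G, hdvd, hl, true_and,
    not_or]
  constructor
  · rintro ⟨hA, hB, hAB, hG, t, hprim, h1, h2⟩
    refine ⟨?_, hA, hB, hAB, hG⟩
    choose s hs using fun i => ZMod.ringHom_surjective (PadicInt.toZModPow (p := p) (8 * l + 1)) (t i)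
    obtain rfl : (fun i => PadicInt.toZModPow (8 * l + 1) (s i)) = t := funext hs
    simp only [hdvd1] at hprim
    rw [← map_intCast (PadicInt.toZModPow (p := p) (8 * l + 1)), ← map_Q1,
      toZModPow_eq_zero_iff] at h1
    rw [← map_intCast (PadicInt.toZModPow (p := p) (8 * l + 1)), ← map_Q2,
      toZModPow_eq_zero_iff] at h2
    obtain ⟨d, hd, hd'⟩ := exists_eq_mul_of_squarefree hsq hpD
    obtain ⟨i, j, hij⟩ := exists_minor_not_dvd hp hd hd' hl hA hB hAB hG hprim h1 h2
    exact (mem_solubleSet_iff D x).2 (exists_primitive_zero _ _ _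
      (exists_primitive_dvd_of_minor _ _ _ (by omega) hprim hij h1 h2))
  · rintro ⟨hsol, hA, hB, hAB, hG⟩
    obtain ⟨t, ⟨i, hi⟩, h1, h2⟩ := (mem_solubleSet_iff D x).1 hsol
    refine ⟨hA, hB, hAB, hG, fun i => PadicInt.toZModPow (8 * l + 1) (t i), ⟨i, ?_⟩, ?_, ?_⟩
    · rwa [hdvd1]
    · rw [← map_intCast (PadicInt.toZModPow (p := p) (8 * l + 1)), ← map_Q1, h1, map_zero]
    · rw [← map_intCast (PadicInt.toZModPow (p := p) (8 * l + 1)), ← map_Q2, h2, map_zero]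

/-- Modulo `p` the point `(1, 1, 1, 0, 0)` is a solution, and its minor 01 is congruent to the unit
`-2`, so it lifts. -/
theorem mem_solubleSet_of_dvd (hp : p ≠ 2) (D : ℤ) {x : ℤ_[p] × ℤ_[p]} (h1 : (p : ℤ_[p]) ∣ x.1)
    (h2 : (p : ℤ_[p]) ∣ x.2) : x ∈ solubleSet D p := by
  refine (mem_solubleSet_iff D x).2 (exists_primitive_zero _ _ _
    (exists_primitive_dvd_of_minor (i := 0) (j := 1) (k := 0) (n := 1) (t := ![1, 1, 1, 0, 0])
      _ _ _ (by norm_num) ⟨0, ?_⟩ ?_ ?_ ?_))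
  · exact fun h => PadicInt.p_nonunit (isUnit_of_dvd_one h)
  · intro h
    have e : minor (D : ℤ_[p]) x.1 x.2 0 1 ![1, 1, 1, 0, 0] = 2 * x.2 * x.1 - 2 := by
      simp [minor, gradQ1, gradQ2]; ring
    rw [e, zero_add, pow_one, dvd_sub_right (h1.mul_left _)] at h
    exact padicInt_two_not_dvd hp h
  · simp [Q1]
  · have e : Q2 (D : ℤ_[p]) x.1 x.2 ![1, 1, 1, 0, 0] = -((1 + x.2) * x.1 + x.2) := by
      simp [Q2]; ring
    rw [e, pow_one]
    exact (dvd_add (h1.mul_left _) h2).neg_right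

theorem reducePair_mem_calRstarSucc_iff (D : ℤ) (l : ℕ) (x : ℤ_[p] × ℤ_[p]) :
    reducePair p (8 * (l + 1) + 1) x ∈ calRstarSucc D p l ↔
      reducePair p (8 * (l + 1) + 1) x ∈ calR D p (l + 1) ∧
        reducePair p (8 * l + 1) x ∉ calR D p l := by
  have h (y : ℤ_[p]) : reduce p l (PadicInt.toZModPow (8 * (l + 1) + 1) y) =
      PadicInt.toZModPow (8 * l + 1) y := by
    rw [reduce, ZMod.castHom_apply, PadicInt.cast_toZModPow _ _ (by omega)]
  simp only [calRstarSucc, Set.mem_ofPred_eq, reducePair, h]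

end Reduction

theorem ncard_badSet_zero_le {q : ℕ} [NeZero q] (hq : Odd q) :
    (badSet (0 : ZMod q)).ncard ≤ 4 * q := by
  have hcard (f : ZMod q → ZMod q × ZMod q) : (Set.range f).ncard ≤ q := by
    rw [← Set.image_univ]
    refine (Set.ncard_image_le Set.finite_univ).trans ?_
    rw [Set.ncard_univ, Nat.card_zmod]
  obtain ⟨c, hc⟩ : ∃ c : ZMod q, 4 * c = 1 := by
    have : IsUnit ((4 : ℕ) : ZMod q) := by
      rw [ZMod.isUnit_iff_coprime]
      exact (Nat.Coprime.pow_left 2 (Nat.coprime_two_left.2 hq) : Nat.Coprime (2 ^ 2) q)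
    obtain ⟨c, hc⟩ := this.exists_right_inv
    exact ⟨c, by simpa using hc⟩
  have hsub : badSet (0 : ZMod q) ⊆ (Set.range (fun u => ((0 : ZMod q), u)) ∪
      Set.range (fun u => (u, (0 : ZMod q)))) ∪ (Set.range (fun u : ZMod q => (u, u)) ∪
      Set.range (fun u : ZMod q => (c * (u + 1) ^ 2, c * (u - 1) ^ 2))) := by
    rintro ⟨a, b⟩ h
    simp only [badSet, Set.mem_ofPred_eq, zero_dvd_iff] at h
    rcases h with h | h | h | h
    · exact Or.inl (Or.inl ⟨b, by simp [h]⟩)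
    · exact Or.inl (Or.inr ⟨a, by simp [h]⟩)
    · exact Or.inr (Or.inl ⟨a, by simp [sub_eq_zero.1 h]⟩)
    -- The conic `G = 0` is parametrised by `u = a - b`: `4a = (u + 1)²` and `4b = (u - 1)²`.
    · refine Or.inr (Or.inr ⟨a - b, ?_⟩)
      simp only [G] at h
      ext
      · simp only
        linear_combination c * h + a * hc
      · simp only
        linear_combination c * h + b * hc
  refine (Set.ncard_le_ncard hsub (Set.toFinite _)).trans ?_
  refine (Set.ncard_union_le _ _).trans ?_
  have h1 := Set.ncard_union_le (Set.range (fun u => ((0 : ZMod q), u)))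
    (Set.range (fun u => (u, (0 : ZMod q))))
  have h2 := Set.ncard_union_le (Set.range (fun u : ZMod q => (u, u)))
    (Set.range (fun u : ZMod q => (c * (u + 1) ^ 2, c * (u - 1) ^ 2)))
  have := hcard (fun u => ((0 : ZMod q), u))
  have := hcard (fun u => (u, (0 : ZMod q)))
  have := hcard (fun u : ZMod q => (u, u))
  have := hcard (fun u : ZMod q => (c * (u + 1) ^ 2, c * (u - 1) ^ 2))
  omega

end BSDSurface

/-! ### Haar measure and the local factors. -/

namespace BSDSurface

section Measure

open MeasureTheory Filter Topology

variable {p : ℕ} [Fact p.Prime]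

theorem reducePair_surjective (n : ℕ) : Function.Surjective (reducePair p n) := by
  rintro ⟨a, b⟩
  obtain ⟨a, rfl⟩ := ZMod.ringHom_surjective (PadicInt.toZModPow (p := p) n) a
  obtain ⟨b, rfl⟩ := ZMod.ringHom_surjective (PadicInt.toZModPow (p := p) n) b
  exact ⟨(a, b), rfl⟩

theorem preimage_reducePair_singleton (n : ℕ) (y : ℤ_[p] × ℤ_[p]) :
    reducePair p n ⁻¹' {reducePair p n y} =
      (fun x => x + -y) ⁻¹' (reducePair p n ⁻¹' {0}) := by
  ext x
  simp only [reducePair, Set.mem_preimage, Set.mem_singleton_iff, Prod.ext_iff, Prod.fst_sub,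
    Prod.snd_sub, map_sub, Prod.fst_zero, Prod.snd_zero, sub_eq_zero, ← sub_eq_add_neg]

theorem isClosed_preimage_reducePair_zero (n : ℕ) : IsClosed (reducePair p n ⁻¹' {0}) := by
  have : reducePair p n ⁻¹' {0} =
      {x | ‖x.1‖ ≤ (p : ℝ) ^ (-n : ℤ)} ∩ {x | ‖x.2‖ ≤ (p : ℝ) ^ (-n : ℤ)} := by
    ext x
    simp only [reducePair, Set.mem_preimage, Set.mem_singleton_iff, Prod.ext_iff, Prod.fst_zero,
      Prod.snd_zero, Set.mem_inter_iff, Set.mem_ofPred_eq, PadicInt.norm_le_pow_iff_mem_span_pow,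
      Ideal.mem_span_singleton, toZModPow_eq_zero_iff]
  rw [this]
  exact (isClosed_le (by fun_prop) continuous_const).inter
    (isClosed_le (by fun_prop) continuous_const)

theorem densityTerm_nonneg (D : ℤ) (p l : ℕ) : 0 ≤ densityTerm D p l := by
  unfold densityTerm; positivity

theorem preimage_calR_subset_succ {D : ℤ} (hp : p ≠ 2) (hsq : Squarefree D) (hpD : (p : ℤ) ∣ D) (l : ℕ) :
    reducePair p (8 * l + 1) ⁻¹' calR D p l ⊆
      reducePair p (8 * (l + 1) + 1) ⁻¹' calR D p (l + 1) := by
  intro x hx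
  have hl : 1 ≤ l := hx.1
  rw [Set.mem_preimage, reducePair_mem_calR_iff hp hsq hpD hl] at hx
  rw [Set.mem_preimage, reducePair_mem_calR_iff hp hsq hpD (by omega)]
  refine ⟨hx.1, fun h => hx.2 ?_⟩
  have hd : (p : ℤ_[p]) ^ (l + 1) ∣ p ^ (l + 1 + 1) := pow_dvd_pow _ (by omega)
  exact h.imp hd.trans (Or.imp hd.trans (Or.imp hd.trans hd.trans))

variable [MeasurableSpace (ℤ_[p] × ℤ_[p])] [BorelSpace (ℤ_[p] × ℤ_[p])]

theorem measurableSet_preimage_reducePair (n : ℕ) (S : Set (ZMod (p ^ n) × ZMod (p ^ n))) :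
    MeasurableSet (reducePair p n ⁻¹' S) := by
  have : NeZero (p ^ n) := ⟨pow_ne_zero _ (Fact.out (p := p.Prime)).ne_zero⟩
  rw [← Set.biUnion_preimage_singleton]
  refine (Set.toFinite S).measurableSet_biUnion fun c _ => ?_
  obtain ⟨y, rfl⟩ := reducePair_surjective n c
  rw [preimage_reducePair_singleton]
  exact ((isClosed_preimage_reducePair_zero n).preimage (by fun_prop)).measurableSet

variable (μ : Measure (ℤ_[p] × ℤ_[p])) [IsProbabilityMeasure μ] [μ.IsAddLeftInvariant]
  {D : ℤ}

/-- The fibres of reduction are translates of one another, so the `p^(2n)` of them share the total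
mass equally. -/
theorem measureReal_preimage_reducePair (n : ℕ) (S : Set (ZMod (p ^ n) × ZMod (p ^ n))) :
    μ.real (reducePair p n ⁻¹' S) = S.ncard / (p : ℝ) ^ (2 * n) := by
  have hp0 := (Fact.out (p := p.Prime)).ne_zero
  have : NeZero (p ^ n) := ⟨pow_ne_zero _ hp0⟩
  have hfib (c) : μ.real (reducePair p n ⁻¹' {c}) = μ.real (reducePair p n ⁻¹' {0}) := by
    obtain ⟨y, rfl⟩ := reducePair_surjective n c
    rw [preimage_reducePair_singleton, measureReal_def, measureReal_def]
    simp only [add_comm _ (-y)]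
    rw [measure_preimage_add]
  have hS (S : Set (ZMod (p ^ n) × ZMod (p ^ n))) :
      μ.real (reducePair p n ⁻¹' S) = S.ncard * μ.real (reducePair p n ⁻¹' {0}) := by
    classical
    have e : reducePair p n ⁻¹' S = ⋃ c ∈ S.toFinset, reducePair p n ⁻¹' {c} := by
      rw [← Set.biUnion_preimage_singleton]
      simp
    rw [e, measureReal_biUnion_finset]
    · simp only [hfib, Finset.sum_const, nsmul_eq_mul, Set.ncard_eq_toFinset_card']
    · intro a _ b _ hab
      exact Disjoint.preimage _ (by simpa using hab)
    · intro c _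
      exact measurableSet_preimage_reducePair n _
  have huniv := hS Set.univ
  rw [Set.preimage_univ, probReal_univ, Set.ncard_univ, Nat.card_prod, Nat.card_zmod] at huniv
  rw [hS, div_eq_mul_inv]
  congr 1
  rw [eq_comm, inv_eq_iff_eq_inv, eq_comm, inv_eq_iff_eq_inv, ← one_div, eq_div_iff, huniv]
  · push_cast; ring
  · positivity

theorem measureReal_badSet_le (hp : p ≠ 2) (m : ℕ) :
    μ.real (badSet ((p : ℤ_[p]) ^ m)) ≤ 4 / (p : ℝ) ^ m := by
  have hpp := Fact.out (p := p.Prime)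
  have : NeZero (p ^ m) := ⟨pow_ne_zero _ hpp.ne_zero⟩
  have e : badSet ((p : ℤ_[p]) ^ m) = reducePair p m ⁻¹' badSet 0 := by
    ext x
    exact (reducePair_mem_badSet_iff x).symm
  rw [e, measureReal_preimage_reducePair]
  have h : ((badSet (0 : ZMod (p ^ m))).ncard : ℝ) ≤ 4 * p ^ m := by
    exact_mod_cast ncard_badSet_zero_le ((hpp.odd_of_ne_two hp).pow (n := m))
  have : (0 : ℝ) < p := by exact_mod_cast hpp.pos
  rw [div_le_div_iff₀ (by positivity) (by positivity)]
  calc _ ≤ (4 * (p : ℝ) ^ m) * p ^ m := by gcongr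
    _ = _ := by ring

/-- Each term is the measure of the difference of two successive sets of an increasing chain, so the
sum telescopes; the chain starts at `𝓡_0 = ∅`. -/
theorem sum_densityTerm_eq_measureReal (hp : p ≠ 2) (hsq : Squarefree D) (hpD : (p : ℤ) ∣ D)
    (l : ℕ) : ∑ i ∈ Finset.range l, densityTerm D p i =
      μ.real (reducePair p (8 * l + 1) ⁻¹' calR D p l) := by
  induction l with
  | zero =>
    have : calR D p 0 = ∅ := Set.eq_empty_of_forall_notMem fun x hx => by
      simpa using hx.1
    simp [this]
  | succ l ih =>
    have e : reducePair p (8 * (l + 1) + 1) ⁻¹' calRstarSucc D p l =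
        reducePair p (8 * (l + 1) + 1) ⁻¹' calR D p (l + 1) \
          reducePair p (8 * l + 1) ⁻¹' calR D p l := by
      ext x
      exact reducePair_mem_calRstarSucc_iff D l x
    have h := measureReal_preimage_reducePair μ _ (calRstarSucc D p l)
    rw [e, measureReal_sdiff (preimage_calR_subset_succ hp hsq hpD l)
      (measurableSet_preimage_reducePair _ _)] at h
    rw [Finset.sum_range_succ, ih, densityTerm, ← h]
    ring

theorem sum_densityTerm_le_measureReal (hp : p ≠ 2) (hsq : Squarefree D) (hpD : (p : ℤ) ∣ D)
    {l : ℕ} (hl : 1 ≤ l) :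
    ∑ i ∈ Finset.range l, densityTerm D p i ≤ μ.real (solubleSet D p) := by
  rw [sum_densityTerm_eq_measureReal μ hp hsq hpD]
  refine measureReal_mono fun x hx => ?_
  exact ((reducePair_mem_calR_iff hp hsq hpD hl x).1 hx).1

/-- A soluble pair missed at level `l` is exceptional. Only monotonicity and subadditivity are used,
so the soluble set need not be known to be measurable. -/
theorem measureReal_le_sum_densityTerm_add (hp : p ≠ 2) (hsq : Squarefree D)
    (hpD : (p : ℤ) ∣ D) {l : ℕ} (hl : 1 ≤ l) :
    μ.real (solubleSet D p) ≤
      ∑ i ∈ Finset.range l, densityTerm D p i + 4 / (p : ℝ) ^ (l + 1) := by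
  rw [sum_densityTerm_eq_measureReal μ hp hsq hpD]
  calc μ.real (solubleSet D p)
      ≤ μ.real (reducePair p (8 * l + 1) ⁻¹' calR D p l ∪ badSet ((p : ℤ_[p]) ^ (l + 1))) := by
        refine measureReal_mono fun x hx => ?_
        by_cases hb : x ∈ badSet ((p : ℤ_[p]) ^ (l + 1))
        · exact Or.inr hb
        · exact Or.inl ((reducePair_mem_calR_iff hp hsq hpD hl x).2 ⟨hx, hb⟩)
    _ ≤ _ := measureReal_union_le _ _
    _ ≤ _ := by gcongr; exact measureReal_badSet_le μ hp _

theorem hasSum_densityTerm (hp : p ≠ 2) (hsq : Squarefree D) (hpD : (p : ℤ) ∣ D) :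
    HasSum (densityTerm D p) (μ.real (solubleSet D p)) := by
  -- The shift by one is there because both bounds require `l ≥ 1`.
  rw [hasSum_iff_tendsto_nat_of_nonneg (densityTerm_nonneg D p), ← tendsto_add_atTop_iff_nat 1]
  have hp1 : (1 : ℝ) < p := by exact_mod_cast (Fact.out (p := p.Prime)).one_lt
  have h4 : Tendsto (fun l : ℕ => μ.real (solubleSet D p) - 4 / (p : ℝ) ^ (l + 1 + 1)) atTop
      (𝓝 (μ.real (solubleSet D p) - 0)) := by
    refine tendsto_const_nhds.sub (Tendsto.div_atTop tendsto_const_nhds ?_)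
    exact (tendsto_pow_atTop_atTop_of_one_lt hp1).comp (tendsto_add_atTop_nat 2)
  rw [sub_zero] at h4
  refine tendsto_of_tendsto_of_tendsto_of_le_of_le h4 tendsto_const_nhds ?_ ?_
  · intro l
    have := measureReal_le_sum_densityTerm_add μ hp hsq hpD (l := l + 1) (by omega)
    simp only
    linarith
  · exact fun l => sum_densityTerm_le_measureReal μ hp hsq hpD (by omega)

theorem inv_sq_le_measureReal_solubleSet (hp : p ≠ 2) :
    1 / (p : ℝ) ^ 2 ≤ μ.real (solubleSet D p) := by
  have h := measureReal_preimage_reducePair μ 1 {0}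
  rw [Set.ncard_singleton, Nat.cast_one, mul_one] at h
  rw [← h]
  refine measureReal_mono fun x hx => ?_
  have hx' : reducePair p 1 x = 0 := hx
  simp only [reducePair, Prod.ext_iff, Prod.fst_zero, Prod.snd_zero, toZModPow_eq_zero_iff,
    pow_one] at hx'
  exact mem_solubleSet_of_dvd hp _ hx'.1 hx'.2

end Measure

section LocalFactor

open MeasureTheory

variable {p : ℕ} [Fact p.Prime] {D : ℤ}

/-- Links the results for an arbitrary invariant probability measure to `localDensity`, whose Borel
structure is local to its definition. -/
theorem exists_haar (p : ℕ) [Fact p.Prime] (D : ℤ) :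
    ∃ (_ : MeasurableSpace (ℤ_[p] × ℤ_[p])) (_ : BorelSpace (ℤ_[p] × ℤ_[p]))
      (μ : Measure (ℤ_[p] × ℤ_[p])), IsProbabilityMeasure μ ∧ μ.IsAddLeftInvariant ∧
        localDensity D p = μ (solubleSet D p) := by
  let _ : MeasurableSpace (ℤ_[p] × ℤ_[p]) := borel (ℤ_[p] × ℤ_[p])
  have : BorelSpace (ℤ_[p] × ℤ_[p]) := ⟨rfl⟩
  refine ⟨inferInstance, inferInstance, Measure.addHaarMeasure ⊤, ⟨?_⟩, inferInstance, rfl⟩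
  exact Measure.addHaarMeasure_self (K₀ := (⊤ : TopologicalSpace.PositiveCompacts (ℤ_[p] × ℤ_[p])))

theorem summable_densityTerm (hp : p ≠ 2) (hsq : Squarefree D) (hpD : (p : ℤ) ∣ D) :
    Summable (densityTerm D p) := by
  obtain ⟨_, _, μ, _, _, -⟩ := exists_haar p D
  exact (hasSum_densityTerm μ hp hsq hpD).summable

theorem localDensity_eq (hp : p ≠ 2) (hsq : Squarefree D) (hpD : (p : ℤ) ∣ D) :
    localDensity D p = ENNReal.ofReal (localFactor D p) := by
  obtain ⟨_, _, μ, _, _, h⟩ := exists_haar p D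
  rw [h, localFactor, (hasSum_densityTerm μ hp hsq hpD).tsum_eq, ofReal_measureReal]

theorem inv_sq_le_localFactor (hp : p ≠ 2) (hsq : Squarefree D) (hpD : (p : ℤ) ∣ D) :
    1 / (p : ℝ) ^ 2 ≤ localFactor D p := by
  obtain ⟨_, _, μ, _, _, h⟩ := exists_haar p D
  rw [localFactor, (hasSum_densityTerm μ hp hsq hpD).tsum_eq]
  exact inv_sq_le_measureReal_solubleSet μ hp

theorem localFactor_le_one (hp : p ≠ 2) (hsq : Squarefree D) (hpD : (p : ℤ) ∣ D) :
    localFactor D p ≤ 1 := by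
  obtain ⟨_, _, μ, _, _, h⟩ := exists_haar p D
  rw [localFactor, (hasSum_densityTerm μ hp hsq hpD).tsum_eq]
  exact measureReal_le_one

theorem ncard_calR_div_le_localFactor (hp : p ≠ 2) (hsq : Squarefree D) (hpD : (p : ℤ) ∣ D)
    {l : ℕ} (hl : 1 ≤ l) :
    ((calR D p l).ncard : ℝ) / (p : ℝ) ^ (2 * (8 * l + 1)) ≤ localFactor D p := by
  obtain ⟨_, _, μ, _, _, h⟩ := exists_haar p D
  rw [localFactor, (hasSum_densityTerm μ hp hsq hpD).tsum_eq,
    ← measureReal_preimage_reducePair μ, ← sum_densityTerm_eq_measureReal μ hp hsq hpD]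
  exact sum_densityTerm_le_measureReal μ hp hsq hpD hl

theorem localFactor_le_ncard_calR_div_add (hp : p ≠ 2) (hsq : Squarefree D) (hpD : (p : ℤ) ∣ D)
    {l : ℕ} (hl : 1 ≤ l) :
    localFactor D p ≤
      ((calR D p l).ncard : ℝ) / (p : ℝ) ^ (2 * (8 * l + 1)) + 4 / (p : ℝ) ^ (l + 1) := by
  obtain ⟨_, _, μ, _, _, h⟩ := exists_haar p D
  rw [localFactor, (hasSum_densityTerm μ hp hsq hpD).tsum_eq,
    ← measureReal_preimage_reducePair μ, ← sum_densityTerm_eq_measureReal μ hp hsq hpD]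
  exact measureReal_le_sum_densityTerm_add μ hp hsq hpD hl

end LocalFactor

end BSDSurface

namespace BSDSurface

/-! ### Counting integer pairs in a box by residue classes. -/

section Counting

open Finset

theorem abs_card_Icc_filter_sub_le {M : ℕ} (hM : 0 < M) (n : ℕ) {N : ℝ} (hn : n ≤ N)
    (hn' : N < n + 1) (c : ZMod M) :
    |((#{a ∈ Icc (-n : ℤ) n | ((a : ℤ) : ZMod M) = c} : ℕ) : ℝ) - 2 * N / M| ≤ 2 := by
  obtain ⟨v, rfl⟩ := ZMod.intCast_surjective c
  have e : ({a ∈ Icc (-n : ℤ) n | ((a : ℤ) : ZMod M) = v}) =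
      {a ∈ Ioc (-n - 1 : ℤ) n | a ≡ v [ZMOD M]} := by
    ext a
    simp only [mem_filter, mem_Icc, mem_Ioc, ZMod.intCast_eq_intCast_iff]
    constructor <;> rintro ⟨h, h'⟩ <;> exact ⟨by omega, h'⟩
  have hMR : (0 : ℝ) < M := by exact_mod_cast hM
  have hM1 : (1 : ℝ) ≤ M := by exact_mod_cast hM
  have hcard := Int.Ioc_filter_modEq_card (-n - 1 : ℤ) n (r := (M : ℤ)) (by exact_mod_cast hM) v
  rw [← e] at hcard
  set r : ℕ := #{a ∈ Icc (-n : ℤ) n | ((a : ℤ) : ZMod M) = v} with hr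
  set x : ℚ := ((n : ℤ) - v : ℚ) / ((M : ℤ) : ℚ) with hx
  set y : ℚ := (((-n - 1 : ℤ) : ℚ) - v) / ((M : ℤ) : ℚ) with hy
  have hxy : x - y = (2 * n + 1) / M := by
    rw [hx, hy, ← sub_div]; push_cast; ring
  have hyx : y ≤ x := by
    rw [← sub_nonneg, hxy]; positivity
  rw [max_eq_left (sub_nonneg.2 (Int.floor_mono hyx))] at hcard
  have h1 := Int.floor_le x
  have h2 := Int.lt_floor_add_one x
  have h3 := Int.floor_le y
  have h4 := Int.lt_floor_add_one y
  have hcard' : (r : ℚ) = ⌊x⌋ - ⌊y⌋ := by exact_mod_cast hcard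
  have hup : (r : ℚ) ≤ (2 * n + 1) / M + 1 := by linarith
  have hlo : (2 * n + 1) / M - 1 ≤ (r : ℚ) := by linarith
  have hup' : (r : ℝ) ≤ (2 * n + 1) / M + 1 := by
    simpa using (Rat.cast_le (K := ℝ)).2 hup
  have hlo' : (2 * n + 1 : ℝ) / M - 1 ≤ r := by
    simpa using (Rat.cast_le (K := ℝ)).2 hlo
  -- One unit of error comes from rounding the count, the other from replacing `2n + 1` by `2N`.
  have hd : |(2 * n + 1 : ℝ) / M - 2 * N / M| ≤ 1 := by
    rw [← sub_div, abs_div, abs_of_pos hMR, div_le_one hMR, abs_le]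
    constructor <;> linarith
  rw [abs_le] at hd ⊢
  constructor <;> linarith

open Classical in
/-- The pairs of integers of absolute value at most `n` whose residue classes modulo `M`
lie in `S`. -/
noncomputable def boxFilter (n M : ℕ) (S : Set (ZMod M × ZMod M)) : Finset (ℤ × ℤ) :=
  {x ∈ Icc (-n : ℤ) n ×ˢ Icc (-n : ℤ) n | ((x.1 : ZMod M), (x.2 : ZMod M)) ∈ S}

theorem mem_boxFilter {n M : ℕ} {S : Set (ZMod M × ZMod M)} {x : ℤ × ℤ} :
    x ∈ boxFilter n M S ↔ x ∈ Icc (-n : ℤ) n ×ˢ Icc (-n : ℤ) n ∧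
      ((x.1 : ZMod M), (x.2 : ZMod M)) ∈ S := by
  classical
  exact mem_filter

theorem abs_card_boxFilter_sub_le {M : ℕ} (hM : 0 < M) (n : ℕ) {N : ℝ} (hn : n ≤ N)
    (hn' : N < n + 1) (S : Set (ZMod M × ZMod M)) :
    |(#(boxFilter n M S) : ℝ) - 4 * N ^ 2 * (S.ncard / (M : ℝ) ^ 2)| ≤
      8 * N * M + 4 * (M : ℝ) ^ 2 := by
  classical
  have : NeZero M := ⟨hM.ne'⟩
  have hMR : (0 : ℝ) < M := by exact_mod_cast hM
  have hN : 0 ≤ N := le_trans (by positivity) hn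
  set m : ℝ := 2 * N / M with hm
  have hm0 : 0 ≤ m := by positivity
  let r (c : ZMod M) : ℕ := #{a ∈ Icc (-n : ℤ) n | ((a : ℤ) : ZMod M) = c}
  have hr (c : ZMod M) : |(r c : ℝ) - m| ≤ 2 := abs_card_Icc_filter_sub_le hM n hn hn' c
  have hcard : #(boxFilter n M S) = ∑ c ∈ S.toFinset, r c.1 * r c.2 := by
    rw [card_eq_sum_card_fiberwise (f := fun x : ℤ × ℤ => ((x.1 : ZMod M), (x.2 : ZMod M)))
      (t := S.toFinset)]
    · refine sum_congr rfl fun c hc => ?_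
      rw [← card_product]
      congr 1
      ext x
      rw [Set.mem_toFinset] at hc
      simp only [boxFilter, mem_filter, mem_product, Prod.ext_iff]
      constructor
      · tauto
      · rintro ⟨⟨h1, h2⟩, h3, h4⟩
        refine ⟨⟨⟨h1, h3⟩, ?_⟩, h2, h4⟩
        rw [h2, h4]; exact hc
    · intro x hx
      simpa using (mem_filter.1 hx).2
  have hterm (c : ZMod M × ZMod M) : |(r c.1 * r c.2 : ℝ) - m ^ 2| ≤ 4 * m + 4 := by
    have e : (r c.1 * r c.2 : ℝ) - m ^ 2 = m * (r c.1 - m) + m * (r c.2 - m) +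
        (r c.1 - m) * (r c.2 - m) := by ring
    rw [e]
    calc _ ≤ |m * (r c.1 - m)| + |m * (r c.2 - m)| + |(r c.1 - m) * (r c.2 - m)| :=
          abs_add_three _ _ _
      _ = m * |r c.1 - m| + m * |r c.2 - m| + |r c.1 - m| * |r c.2 - m| := by
          simp only [abs_mul, abs_of_nonneg hm0]
      _ ≤ m * 2 + m * 2 + 2 * 2 := by
          gcongr <;> exact hr _
      _ = _ := by ring
  have hScard : (S.ncard : ℝ) ≤ M ^ 2 := by
    have := Set.ncard_le_card S
    rw [Nat.card_prod, Nat.card_zmod, ← pow_two] at this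
    exact_mod_cast this
  have e : (#(boxFilter n M S) : ℝ) - 4 * N ^ 2 * (S.ncard / (M : ℝ) ^ 2) =
      ∑ c ∈ S.toFinset, ((r c.1 * r c.2 : ℝ) - m ^ 2) := by
    rw [hcard, sum_sub_distrib, sum_const, nsmul_eq_mul, Set.ncard_eq_toFinset_card', hm]
    push_cast
    field_simp
    ring
  rw [e]
  calc _ ≤ ∑ c ∈ S.toFinset, |(r c.1 * r c.2 : ℝ) - m ^ 2| := abs_sum_le_sum_abs _ _
    _ ≤ ∑ c ∈ S.toFinset, (4 * m + 4) := sum_le_sum fun c _ => hterm c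
    _ = S.ncard * (4 * m + 4) := by
        rw [sum_const, nsmul_eq_mul, Set.ncard_eq_toFinset_card']
    _ ≤ M ^ 2 * (4 * m + 4) := by gcongr
    _ = _ := by rw [hm]; field_simp; ring

theorem card_boxFilter_badSet_le {q : ℕ} (hq : Odd q) (n : ℕ) {N : ℝ} (hn : n ≤ N)
    (hn' : N < n + 1) :
    (#(boxFilter n q (badSet 0)) : ℝ) ≤ 16 * N ^ 2 / q + 8 * N * q + 4 * (q : ℝ) ^ 2 := by
  have hq0 : 0 < q := hq.pos
  have : NeZero q := ⟨hq0.ne'⟩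
  have hqR : (0 : ℝ) < q := by exact_mod_cast hq0
  have h := (abs_le.1 (abs_card_boxFilter_sub_le hq0 n hn hn' (badSet 0))).2
  have hb : ((badSet (0 : ZMod q)).ncard : ℝ) ≤ 4 * q := by
    exact_mod_cast ncard_badSet_zero_le hq
  have h4 : 4 * N ^ 2 * (((badSet (0 : ZMod q)).ncard : ℝ) / (q : ℝ) ^ 2) ≤ 16 * N ^ 2 / q := by
    calc _ ≤ 4 * N ^ 2 * (4 * q / (q : ℝ) ^ 2) := by gcongr
      _ = _ := by field_simp; ring
  linarith

open Function in
theorem ncard_setOf_forall_prodEquivPi_mem {ι : Type*} [Fintype ι] (a : ι → ℕ)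
    (hc : Pairwise (Nat.Coprime on a)) (R : ∀ i, Set (ZMod (a i) × ZMod (a i))) :
    {x : ZMod (∏ i, a i) × ZMod (∏ i, a i) |
      ∀ i, (ZMod.prodEquivPi a hc x.1 i, ZMod.prodEquivPi a hc x.2 i) ∈ R i}.ncard =
      ∏ i, (R i).ncard := by
  set f : ZMod (∏ i, a i) × ZMod (∏ i, a i) → ∀ i, ZMod (a i) × ZMod (a i) :=
    fun x i => (ZMod.prodEquivPi a hc x.1 i, ZMod.prodEquivPi a hc x.2 i) with hf
  have hinj : Injective f := by
    intro x y hxy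
    ext
    · exact (ZMod.prodEquivPi a hc).injective (funext fun i => congrArg Prod.fst (congrFun hxy i))
    · exact (ZMod.prodEquivPi a hc).injective (funext fun i => congrArg Prod.snd (congrFun hxy i))
  have himg : f '' {x | ∀ i, f x i ∈ R i} = Set.pi Set.univ R := by
    ext z
    constructor
    · rintro ⟨x, hx, rfl⟩ i -
      exact hx i
    · intro hz
      obtain ⟨u, hu⟩ := (ZMod.prodEquivPi a hc).surjective fun i => (z i).1
      obtain ⟨v, hv⟩ := (ZMod.prodEquivPi a hc).surjective fun i => (z i).2
      have huv : f (u, v) = z := by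
        funext i
        exact Prod.ext (congrFun hu i) (congrFun hv i)
      exact ⟨(u, v), fun i => huv ▸ hz i trivial, huv⟩
  have h1 := Set.ncard_image_of_injective {x | ∀ i, f x i ∈ R i} hinj
  rw [himg, ← Nat.card_coe_set_eq, Nat.card_congr (Equiv.Set.univPi R), Nat.card_pi] at h1
  simp only [Nat.card_coe_set_eq] at h1
  exact h1.symm

/-- Used to compare the product of the truncated local factors with `cloc D / 4`. -/
theorem abs_prod_sub_prod_le {ι : Type*} (s : Finset ι) (a b : ι → ℝ)
    (ha : ∀ i ∈ s, |a i| ≤ 1) (hb : ∀ i ∈ s, |b i| ≤ 1) :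
    |∏ i ∈ s, a i - ∏ i ∈ s, b i| ≤ ∑ i ∈ s, |a i - b i| := by
  classical
  induction s using Finset.induction_on with
  | empty => simp
  | insert i s hi ih =>
    rw [prod_insert hi, prod_insert hi, sum_insert hi]
    have h1 := ih (fun j hj => ha j (mem_insert_of_mem hj)) fun j hj => hb j (mem_insert_of_mem hj)
    have hbi := hb i (mem_insert_self i s)
    have hpa : |∏ j ∈ s, a j| ≤ 1 := by
      rw [abs_prod]
      exact prod_le_one (fun _ _ => abs_nonneg _) fun j hj => ha j (mem_insert_of_mem hj)
    calc |a i * ∏ j ∈ s, a j - b i * ∏ j ∈ s, b j|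
        = |(a i - b i) * ∏ j ∈ s, a j + b i * (∏ j ∈ s, a j - ∏ j ∈ s, b j)| := by
          congr 1; ring
      _ ≤ |a i - b i| * |∏ j ∈ s, a j| + |b i| * |∏ j ∈ s, a j - ∏ j ∈ s, b j| := by
          rw [← abs_mul, ← abs_mul]; exact abs_add_le _ _
      _ ≤ |a i - b i| * 1 + 1 * ∑ j ∈ s, |a j - b j| := by gcongr
      _ = _ := by ring

end Counting

end BSDSurface

/-! ### The global count and the power saving. -/

namespace BSDSurface

section Assembly

open Finset

theorem ne_two_of_dvd {D : ℤ} (hD : D ≡ 1 [ZMOD 8]) {p : ℕ} (hpD : (p : ℤ) ∣ D) : p ≠ 2 := by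
  rintro rfl
  have : D % 8 = 1 := hD
  omega

theorem Rloc_eq_card (D : ℤ) {n : ℕ} {N : ℝ} (hn : n ≤ N) (hn' : N < n + 1)
    [DecidablePred fun x : ℤ × ℤ => EverywhereLocallySoluble D x.1 x.2] :
    Rloc D N = #{x ∈ Icc (-n : ℤ) n ×ˢ Icc (-n : ℤ) n |
      EverywhereLocallySoluble D x.1 x.2} := by
  rw [Rloc, ← Set.ncard_coe_finset]
  congr 1
  have h (a : ℤ) : |(a : ℝ)| ≤ N ↔ -(n : ℤ) ≤ a ∧ a ≤ n := by
    rw [← abs_le, ← Int.cast_abs]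
    constructor
    · intro h
      have : ((|a| : ℤ) : ℝ) < ((n + 1 : ℤ) : ℝ) := by push_cast; push_cast at h; linarith
      have : |a| < n + 1 := by exact_mod_cast this
      omega
    · intro h
      have : ((|a| : ℤ) : ℝ) ≤ ((n : ℤ) : ℝ) := by exact_mod_cast h
      exact this.trans (by simpa using hn)
  ext x
  simp only [Set.mem_ofPred_eq, h, coe_filter, mem_product, mem_Icc]
  tauto

variable {D : ℤ}

theorem reducePair_intCast (p : ℕ) [Fact p.Prime] (n : ℕ) (A B : ℤ) :
    reducePair p n ((A : ℤ_[p]), (B : ℤ_[p])) = ((A : ZMod (p ^ n)), (B : ZMod (p ^ n))) := by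
  simp [reducePair]

open Function in
theorem pairwise_coprime_primeFactors_pow (D : ℤ) (n : ℕ) :
    Pairwise (Nat.Coprime on fun p : D.natAbs.primeFactors => (p : ℕ) ^ n) := by
  intro p q hpq
  refine Nat.Coprime.pow _ _ ((Nat.coprime_primes (Nat.prime_of_mem_primeFactors p.2)
    (Nat.prime_of_mem_primeFactors q.2)).2 fun h => hpq (Subtype.ext h))

theorem prod_primeFactors_pow (hsq : Squarefree D) (n : ℕ) :
    ∏ p : D.natAbs.primeFactors, (p : ℕ) ^ n = D.natAbs ^ n := by
  rw [Finset.prod_coe_sort D.natAbs.primeFactors fun p => p ^ n, Finset.prod_pow,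
    Nat.prod_primeFactors_of_squarefree (Int.squarefree_natAbs.2 hsq)]

/-- The pairs of residue classes modulo `∏ p ^ (8 * l + 1)`, for `p` dividing `D`, which lie in
`calR D p l` for all these `p`. -/
def globalR (D : ℤ) (l : ℕ) :
    Set (ZMod (∏ p : D.natAbs.primeFactors, (p : ℕ) ^ (8 * l + 1)) ×
      ZMod (∏ p : D.natAbs.primeFactors, (p : ℕ) ^ (8 * l + 1))) :=
  {x | ∀ p : D.natAbs.primeFactors,
    (ZMod.prodEquivPi _ (pairwise_coprime_primeFactors_pow D (8 * l + 1)) x.1 p,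
      ZMod.prodEquivPi _ (pairwise_coprime_primeFactors_pow D (8 * l + 1)) x.2 p) ∈ calR D p l}

theorem intCast_mem_globalR_iff (D : ℤ) (l : ℕ) (A B : ℤ) :
    ((A : ZMod _), (B : ZMod _)) ∈ globalR D l ↔
      ∀ p ∈ D.natAbs.primeFactors,
        ((A : ZMod (p ^ (8 * l + 1))), (B : ZMod (p ^ (8 * l + 1)))) ∈ calR D p l := by
  simp only [globalR, Set.mem_ofPred_eq, map_intCast, Pi.intCast_apply, Subtype.forall]

theorem ncard_globalR_div (D : ℤ) (l : ℕ) :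
    ((globalR D l).ncard : ℝ) /
        ((∏ p : D.natAbs.primeFactors, (p : ℕ) ^ (8 * l + 1) : ℕ) : ℝ) ^ 2 =
      ∏ p ∈ D.natAbs.primeFactors,
        ((calR D p l).ncard : ℝ) / (p : ℝ) ^ (2 * (8 * l + 1)) := by
  rw [globalR, ncard_setOf_forall_prodEquivPi_mem (fun p : D.natAbs.primeFactors =>
    (p : ℕ) ^ (8 * l + 1)) _ fun p => calR D p l,
    ← Finset.prod_coe_sort D.natAbs.primeFactors fun p =>
      ((calR D p l).ncard : ℝ) / (p : ℝ) ^ (2 * (8 * l + 1))]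
  push_cast
  rw [← Finset.prod_pow, ← Finset.prod_div_distrib]
  refine Finset.prod_congr rfl fun p _ => ?_
  rw [← pow_mul, mul_comm 2]

theorem dvd_of_mem_primeFactors {p : ℕ} (hp : p ∈ D.natAbs.primeFactors) : (p : ℤ) ∣ D :=
  Int.natCast_dvd.2 (Nat.dvd_of_mem_primeFactors hp)

theorem three_le_of_mem_primeFactors (hD : D ≡ 1 [ZMOD 8]) {p : ℕ}
    (hp : p ∈ D.natAbs.primeFactors) : 3 ≤ p := by
  have h1 := (Nat.prime_of_mem_primeFactors hp).two_le
  have h2 := ne_two_of_dvd hD (dvd_of_mem_primeFactors hp)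
  omega

theorem boxFilter_globalR_subset (hpos : 0 < D) (hsq : Squarefree D) (hD : D ≡ 1 [ZMOD 8])
    {l : ℕ} (hl : 1 ≤ l) (n : ℕ)
    [DecidablePred fun x : ℤ × ℤ => EverywhereLocallySoluble D x.1 x.2] :
    boxFilter n _ (globalR D l) ⊆
      {x ∈ Icc (-n : ℤ) n ×ˢ Icc (-n : ℤ) n | EverywhereLocallySoluble D x.1 x.2} := by
  intro x hx
  rw [mem_boxFilter, intCast_mem_globalR_iff] at hx
  refine mem_filter.2 ⟨hx.1, (everywhereLocallySoluble_iff hpos hD _ _).2 fun p hp hpD => ?_⟩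
  have hmem : p ∈ D.natAbs.primeFactors :=
    Nat.mem_primeFactors.2 ⟨hp.out, Int.natCast_dvd.1 hpD, by omega⟩
  have := hx.2 p hmem
  rw [← reducePair_intCast, reducePair_mem_calR_iff (ne_two_of_dvd hD hpD) hsq hpD hl] at this
  exact this.1

/-- Upper half of the sandwich: a soluble pair that is exceptional at no `p ∣ D` is detected at
level `l` at each of them. -/
theorem filter_subset_boxFilter_union (hpos : 0 < D) (hsq : Squarefree D) (hD : D ≡ 1 [ZMOD 8])
    {l : ℕ} (hl : 1 ≤ l) (n : ℕ)
    [DecidablePred fun x : ℤ × ℤ => EverywhereLocallySoluble D x.1 x.2] :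
    {x ∈ Icc (-n : ℤ) n ×ˢ Icc (-n : ℤ) n | EverywhereLocallySoluble D x.1 x.2} ⊆
      boxFilter n _ (globalR D l) ∪
        D.natAbs.primeFactors.biUnion fun p => boxFilter n (p ^ (l + 1)) (badSet 0) := by
  intro x hx
  rw [mem_filter, everywhereLocallySoluble_iff hpos hD] at hx
  rw [mem_union, or_iff_not_imp_right, mem_biUnion]
  intro hbad
  refine mem_boxFilter.2 ⟨hx.1, (intCast_mem_globalR_iff D l _ _).2 fun p hp => ?_⟩
  have hpD := dvd_of_mem_primeFactors hp
  have : Fact p.Prime := ⟨Nat.prime_of_mem_primeFactors hp⟩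
  rw [← reducePair_intCast, reducePair_mem_calR_iff (ne_two_of_dvd hD hpD) hsq hpD hl,
    ← reducePair_mem_badSet_iff, reducePair_intCast]
  exact ⟨hx.2 p hpD, fun h => hbad ⟨p, hp, mem_boxFilter.2 ⟨hx.1, h⟩⟩⟩

theorem abs_Rloc_sub_le (hpos : 0 < D) (hsq : Squarefree D) (hD : D ≡ 1 [ZMOD 8]) {l : ℕ}
    (hl : 1 ≤ l) {N : ℝ} (hN : 0 ≤ N) :
    |(Rloc D N : ℝ) - cloc D * N ^ 2| ≤
      32 * (#D.natAbs.primeFactors + 1) * (N ^ 2 / 3 ^ l + N * (D : ℝ) ^ (8 * l + 1) +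
        ((D : ℝ) ^ (8 * l + 1)) ^ 2) := by
  classical
  have hn : (⌊N⌋₊ : ℝ) ≤ N := Nat.floor_le hN
  have hn' : N < ⌊N⌋₊ + 1 := Nat.lt_floor_add_one N
  set n := ⌊N⌋₊
  set P := D.natAbs.primeFactors with hP
  set ω : ℝ := ((#P : ℕ) : ℝ) with hω
  set M : ℝ := (D : ℝ) ^ (8 * l + 1) with hM
  set T := ({x ∈ Icc (-n : ℤ) n ×ˢ Icc (-n : ℤ) n | EverywhereLocallySoluble D x.1 x.2}) with hT
  have hD1 : (1 : ℝ) ≤ D := by exact_mod_cast hpos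
  have hMM : ((∏ p : D.natAbs.primeFactors, (p : ℕ) ^ (8 * l + 1) : ℕ) : ℝ) = M := by
    rw [prod_primeFactors_pow hsq, hM, Nat.cast_pow, Nat.cast_natAbs, abs_of_pos hpos]
  have hM0 : 0 < ∏ p : D.natAbs.primeFactors, (p : ℕ) ^ (8 * l + 1) := by
    rw [prod_primeFactors_pow hsq]
    exact pow_pos (by omega) _
  have hMpos : 1 ≤ M := one_le_pow₀ hD1
  have h3 (p : ℕ) (hp : p ∈ P) : (3 : ℝ) ≤ p := by
    exact_mod_cast three_le_of_mem_primeFactors hD hp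
  -- All primes dividing `D` are at least `3`, so `3^l` serves as a bound uniform in `p`.
  have h3l (p : ℕ) (hp : p ∈ P) : (3 : ℝ) ^ l ≤ (p : ℝ) ^ (l + 1) := by
    have := h3 p hp
    calc (3 : ℝ) ^ l ≤ 3 ^ (l + 1) := pow_le_pow_right₀ (by norm_num) (by omega)
      _ ≤ _ := by gcongr
  have hpM (p : ℕ) (hp : p ∈ P) : (p : ℝ) ^ (l + 1) ≤ M := by
    have hpD : (p : ℝ) ≤ D := by exact_mod_cast Int.le_of_dvd hpos (dvd_of_mem_primeFactors hp)
    calc (p : ℝ) ^ (l + 1) ≤ (D : ℝ) ^ (l + 1) := by gcongr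
      _ ≤ _ := pow_le_pow_right₀ hD1 (by omega)
  have hcount : |(Rloc D N : ℝ) - #(boxFilter n _ (globalR D l))| ≤
      ω * (16 * N ^ 2 / 3 ^ l + 8 * N * M + 4 * M ^ 2) := by
    rw [Rloc_eq_card D hn hn', abs_of_nonneg]
    · have h1 := card_le_card (filter_subset_boxFilter_union hpos hsq hD hl n)
      have h2 := h1.trans (card_union_le _ _)
      have h3 := h2.trans (Nat.add_le_add_left card_biUnion_le _)
      have h4 : ((#T : ℕ) : ℝ) ≤ #(boxFilter n _ (globalR D l)) +
          ∑ p ∈ P, (#(boxFilter n (p ^ (l + 1)) (badSet 0)) : ℝ) := by exact_mod_cast h3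
      have h5 : ∑ p ∈ P, (#(boxFilter n (p ^ (l + 1)) (badSet 0)) : ℝ) ≤
          ∑ p ∈ P, (16 * N ^ 2 / 3 ^ l + 8 * N * M + 4 * M ^ 2) := by
        refine sum_le_sum fun p hp => ?_
        have hodd : Odd (p ^ (l + 1)) := ((Nat.prime_of_mem_primeFactors hp).odd_of_ne_two
          (ne_two_of_dvd hD (dvd_of_mem_primeFactors hp))).pow
        refine (card_boxFilter_badSet_le hodd n hn hn').trans ?_
        have ha := h3l p hp
        have hb := hpM p hp
        push_cast
        gcongr
      rw [sum_const, nsmul_eq_mul] at h5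
      linarith
    · rw [sub_nonneg]
      exact_mod_cast card_le_card (boxFilter_globalR_subset hpos hsq hD hl n)
  have hbox := abs_card_boxFilter_sub_le hM0 n hn hn' (globalR D l)
  rw [ncard_globalR_div, hMM] at hbox
  have hprod : |∏ p ∈ P, ((calR D p l).ncard : ℝ) / (p : ℝ) ^ (2 * (8 * l + 1)) -
      ∏ p ∈ P, localFactor D p| ≤ ω * (4 / 3 ^ l) := by
    have key (p : ℕ) (hp : p ∈ P) :
        0 ≤ ((calR D p l).ncard : ℝ) / (p : ℝ) ^ (2 * (8 * l + 1)) ∧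
        ((calR D p l).ncard : ℝ) / (p : ℝ) ^ (2 * (8 * l + 1)) ≤ localFactor D p ∧
        localFactor D p ≤ 1 ∧ localFactor D p ≤
        ((calR D p l).ncard : ℝ) / (p : ℝ) ^ (2 * (8 * l + 1)) + 4 / (p : ℝ) ^ (l + 1) := by
      have hpD := dvd_of_mem_primeFactors hp
      have : Fact p.Prime := ⟨Nat.prime_of_mem_primeFactors hp⟩
      have hp2 := ne_two_of_dvd hD hpD
      exact ⟨by positivity, ncard_calR_div_le_localFactor hp2 hsq hpD hl,
        localFactor_le_one hp2 hsq hpD, localFactor_le_ncard_calR_div_add hp2 hsq hpD hl⟩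
    refine (abs_prod_sub_prod_le P _ _ (fun p hp => ?_) fun p hp => ?_).trans ?_
    · obtain ⟨h1, h2, h3, -⟩ := key p hp
      exact abs_le.2 ⟨by linarith, by linarith⟩
    · obtain ⟨h1, h2, h3, -⟩ := key p hp
      exact abs_le.2 ⟨by linarith, by linarith⟩
    · rw [← nsmul_eq_mul, ← sum_const]
      refine sum_le_sum fun p hp => ?_
      obtain ⟨-, h2, -, h4⟩ := key p hp
      have h5 : 4 / (p : ℝ) ^ (l + 1) ≤ 4 / 3 ^ l := by
        have := h3l p hp
        gcongr
      exact abs_le.2 ⟨by linarith, by linarith [show (0 : ℝ) ≤ 4 / 3 ^ l by positivity]⟩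
  have hmain : |4 * N ^ 2 * ∏ p ∈ P, ((calR D p l).ncard : ℝ) / (p : ℝ) ^ (2 * (8 * l + 1)) -
      cloc D * N ^ 2| ≤ 4 * N ^ 2 * (ω * (4 / 3 ^ l)) := by
    have e : 4 * N ^ 2 * ∏ p ∈ P, ((calR D p l).ncard : ℝ) / (p : ℝ) ^ (2 * (8 * l + 1)) -
        cloc D * N ^ 2 = 4 * N ^ 2 * (∏ p ∈ P, ((calR D p l).ncard : ℝ) /
          (p : ℝ) ^ (2 * (8 * l + 1)) - ∏ p ∈ P, localFactor D p) := by
      rw [cloc]; ring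
    rw [e, abs_mul, abs_of_nonneg (by positivity)]
    gcongr
  have htri := abs_sub_le (Rloc D N : ℝ) (#(boxFilter n _ (globalR D l))) (cloc D * N ^ 2)
  have htri' := abs_sub_le (#(boxFilter n _ (globalR D l)) : ℝ)
    (4 * N ^ 2 * ∏ p ∈ P, ((calR D p l).ncard : ℝ) / (p : ℝ) ^ (2 * (8 * l + 1)))
    (cloc D * N ^ 2)
  have hω0 : 0 ≤ ω := by positivity
  have hX : 0 ≤ N ^ 2 / 3 ^ l := by positivity
  have hY : 0 ≤ N * M := by positivity
  have hZ : 0 ≤ M ^ 2 := by positivity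
  calc _ ≤ ω * (16 * N ^ 2 / 3 ^ l + 8 * N * M + 4 * M ^ 2) +
        (8 * N * M + 4 * M ^ 2 + 4 * N ^ 2 * (ω * (4 / 3 ^ l))) := by linarith
    _ = 32 * ω * (N ^ 2 / 3 ^ l) + 8 * (ω + 1) * (N * M) + 4 * (ω + 1) * M ^ 2 := by ring
    _ ≤ 32 * (ω + 1) * (N ^ 2 / 3 ^ l) + 32 * (ω + 1) * (N * M) + 32 * (ω + 1) * M ^ 2 := by
        gcongr <;> linarith
    _ = _ := by ring

theorem exists_power_saving {D : ℝ} (hD : 1 ≤ D) :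
    ∃ θ : ℝ, 0 < θ ∧ ∃ C : ℝ, ∀ N : ℝ, 1 ≤ N → ∃ l : ℕ, 1 ≤ l ∧
      N ^ 2 / 3 ^ l + N * D ^ (8 * l + 1) + (D ^ (8 * l + 1)) ^ 2 ≤ C * N ^ (2 - θ) := by
  -- `D + 1` instead of `D` keeps the logarithm positive when `D = 1`.
  set L := Real.log (D + 1) with hL
  have hLpos : 0 < L := Real.log_pos (by linarith)
  have hlog3 : 0 < Real.log 3 := Real.log_pos (by norm_num)
  -- The bound `1/2` is what `N * M ≪ N^(3/2)` allows; the other comes from `3^z = N^(log 3 / (16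
  -- L))`.
  refine ⟨min (1 / 2) (Real.log 3 / (16 * L)), lt_min (by norm_num) (by positivity),
    1 + (D + 1) ^ 9 + ((D + 1) ^ 9) ^ 2, fun N hN => ?_⟩
  set θ := min (1 / 2) (Real.log 3 / (16 * L)) with hθ
  have hθ1 : θ ≤ 1 / 2 := min_le_left _ _
  have hθ2 : θ ≤ Real.log 3 / (16 * L) := min_le_right _ _
  have hN0 : 0 < N := by linarith
  have hlogN : 0 ≤ Real.log N := Real.log_nonneg hN
  -- Chosen so that `(D + 1)^(8z) = N^(1/2)`. Rounding to `l = ⌊z⌋₊ + 1` costs the factor `(D +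
  -- 1)^9`.
  set z := Real.log N / (16 * L) with hz
  have hz0 : 0 ≤ z := by positivity
  refine ⟨⌊z⌋₊ + 1, by omega, ?_⟩
  have hfl : (⌊z⌋₊ : ℝ) ≤ z := Nat.floor_le hz0
  have hfl' : z ≤ ((⌊z⌋₊ + 1 : ℕ) : ℝ) := by push_cast; exact (Nat.lt_floor_add_one z).le
  have hD0 : 0 < D + 1 := by linarith
  have hM : D ^ (8 * (⌊z⌋₊ + 1) + 1) ≤ (D + 1) ^ 9 * N ^ (1 / 2 : ℝ) := by
    calc D ^ (8 * (⌊z⌋₊ + 1) + 1) ≤ (D + 1) ^ (8 * (⌊z⌋₊ + 1) + 1) := by gcongr; linarith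
      _ = (D + 1) ^ 9 * (D + 1) ^ (8 * ⌊z⌋₊) := by ring
      _ ≤ (D + 1) ^ 9 * N ^ (1 / 2 : ℝ) := by
        gcongr
        rw [← Real.rpow_natCast, Real.rpow_def_of_pos hD0, Real.rpow_def_of_pos hN0]
        refine Real.exp_le_exp.2 ?_
        push_cast
        calc L * (8 * ⌊z⌋₊) ≤ L * (8 * z) := by gcongr
          _ = _ := by rw [hz]; field_simp; ring
  have h3 : N ^ θ ≤ 3 ^ (⌊z⌋₊ + 1) := by
    rw [← Real.rpow_natCast 3, Real.rpow_def_of_pos hN0, Real.rpow_def_of_pos (by norm_num)]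
    refine Real.exp_le_exp.2 ?_
    calc Real.log N * θ ≤ Real.log N * (Real.log 3 / (16 * L)) := by gcongr
      _ = Real.log 3 * z := by rw [hz]; ring
      _ ≤ _ := by gcongr
  have hD9 : 0 ≤ (D + 1) ^ 9 := by positivity
  have t1 : N ^ 2 / 3 ^ (⌊z⌋₊ + 1) ≤ N ^ (2 - θ) := by
    rw [Real.rpow_sub hN0, Real.rpow_two]
    gcongr
  have t2 : N * D ^ (8 * (⌊z⌋₊ + 1) + 1) ≤ (D + 1) ^ 9 * N ^ (2 - θ) := by
    calc _ ≤ N * ((D + 1) ^ 9 * N ^ (1 / 2 : ℝ)) := by gcongr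
      _ = (D + 1) ^ 9 * N ^ (1 + 1 / 2 : ℝ) := by
        rw [Real.rpow_add hN0, Real.rpow_one]; ring
      _ ≤ _ := by
        gcongr
        linarith
  have t3 : (D ^ (8 * (⌊z⌋₊ + 1) + 1)) ^ 2 ≤ ((D + 1) ^ 9) ^ 2 * N ^ (2 - θ) := by
    calc _ ≤ ((D + 1) ^ 9 * N ^ (1 / 2 : ℝ)) ^ 2 := by gcongr
      _ = ((D + 1) ^ 9) ^ 2 * N ^ (1 : ℝ) := by
        rw [mul_pow, ← Real.rpow_natCast (N ^ (1 / 2 : ℝ)), ← Real.rpow_mul hN0.le]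
        norm_num
      _ ≤ _ := by
        gcongr
        linarith
  linarith

theorem four_div_sq_le_cloc (hpos : 0 < D) (hsq : Squarefree D) (hD : D ≡ 1 [ZMOD 8]) :
    4 / (D : ℝ) ^ 2 ≤ cloc D := by
  have e : (D : ℝ) = ∏ p ∈ D.natAbs.primeFactors, (p : ℝ) := by
    rw [← Nat.cast_prod, Nat.prod_primeFactors_of_squarefree (Int.squarefree_natAbs.2 hsq),
      Nat.cast_natAbs, abs_of_pos hpos]
  rw [cloc, div_eq_mul_one_div]
  refine mul_le_mul_of_nonneg_left ?_ (by norm_num)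
  rw [e, ← Finset.prod_pow, one_div, ← Finset.prod_inv_distrib]
  refine Finset.prod_le_prod (fun p _ => by positivity) fun p hp => ?_
  have hpD := dvd_of_mem_primeFactors hp
  have : Fact p.Prime := ⟨Nat.prime_of_mem_primeFactors hp⟩
  rw [← one_div]
  exact inv_sq_le_localFactor (ne_two_of_dvd hD hpD) hsq hpD

end Assembly

end BSDSurface

theorem proposition1 (D : ℤ) (hpos : 0 < D) (hsq : Squarefree D) (hD : D ≡ 1 [ZMOD 8]) :
    (∃ θ : ℝ, 0 < θ ∧ ∃ C : ℝ, ∀ N : ℝ, 1 ≤ N →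
      |(BSDSurface.Rloc D N : ℝ) - BSDSurface.cloc D * N ^ 2| ≤ C * N ^ (2 - θ)) ∧
    0 < BSDSurface.cloc D ∧
    4 / (D : ℝ) ^ 2 ≤ BSDSurface.cloc D ∧
    (∀ p : ℕ, p.Prime → (p : ℤ) ∣ D → Summable (BSDSurface.densityTerm D p)) ∧
    (∀ (p : ℕ) [Fact p.Prime], (p : ℤ) ∣ D →
      BSDSurface.localDensity D p = ENNReal.ofReal (BSDSurface.localFactor D p)) := by
  have hD1 : (1 : ℝ) ≤ D := by exact_mod_cast hpos
  have hc := BSDSurface.four_div_sq_le_cloc hpos hsq hD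
  refine ⟨?_, lt_of_lt_of_le (by positivity) hc, hc, fun p hp hpD => ?_, fun p _ hpD => ?_⟩
  · obtain ⟨θ, hθ, C, h⟩ := BSDSurface.exists_power_saving hD1
    refine ⟨θ, hθ, 32 * (D.natAbs.primeFactors.card + 1) * C, fun N hN => ?_⟩
    obtain ⟨l, hl, hle⟩ := h N hN
    refine (BSDSurface.abs_Rloc_sub_le hpos hsq hD hl (by linarith)).trans ?_
    rw [mul_assoc _ C]
    gcongr
  · have : Fact p.Prime := ⟨hp⟩
    exact BSDSurface.summable_densityTerm (BSDSurface.ne_two_of_dvd hD hpD) hsq hpD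
  · exact BSDSurface.localDensity_eq (BSDSurface.ne_two_of_dvd hD hpD) hsq hpD
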